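/- Let $I=(0,1)$, $0<a<b$ and $c_l>0$, and identify $\mathbb{R}^2$ with $\mathbb{C}$. Let $f=-e_2$ and $F(t)=\int_t^1 f(s)\,ds=-(1-t)e_2$. Let $$X=\{K\in W^{1,2}(I): K(0)=0\},\qquad \tilde X=\{K\in X: K(t)\in(-\tfrac{\pi}{2},0]\text{ for all }t\in[0,1)\},$$ where $W^{1,2}$ functions are identified with their continuous representatives on $[0,1]$. For $\theta\in L^\infty(I;[0,1])$ put $A(\theta)=\left(\frac{1-\theta}{a}+\frac{\theta}{b}\right)^{-1}$. Then for every $\theta\in L^\infty(I;[0,1])$ there is a unique $K=K(\theta)\in\tilde X$ solving the state equation $(A(\theta)K')'=-ie^{iK}\cdot F$ in the dual $X'$ of $X$, i.e. $$\int_I A(\theta)K'\varphi'\,dt-\int_I \left(F\cdot ie^{iK}\right)\varphi\,dt=0\qquad\text{for all }\varphi\in X .$$ Define $$\hat J(\theta)=\int_I F\cdot e^{iK(\theta)}\,dt+c_l\int_I\theta\,dt .$$ Then the infimum $\inf_{\theta\in L^\infty(I;[0,1])}\hat J(\theta)$ is attained, and it equals the infimum $\inf_{\chi\in L^\infty(I;\{0,1\})}\hat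 J(\chi)$ over classical designs. -/

import Mathlib

open MeasureTheory Set

noncomputable section

namespace Beam

/-- Lebesgue measure on the open interval `I = (0, 1)`. -/
abbrev volI : Measure ℝ := volume.restrict (Ioo (0 : ℝ) 1)

/-- A continuous function on `[0, 1]`, regarded as a function of a real variable; only its values
on `[0, 1]` are ever used. -/
abbrev extendK (K : C(Icc (0 : ℝ) 1, ℝ)) : ℝ → ℝ := IccExtend zero_le_one K

/-- `g ∈ L²(I)` is the weak derivative of `K` on `I`, tested against `C_c^∞(I)`. -/
def HasWeakDeriv (K : C(Icc (0 : ℝ) 1, ℝ)) (g : ℝ → ℝ) : Prop :=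
  MemLp g 2 volI ∧
    ∀ φ : ℝ → ℝ, ContDiff ℝ ((⊤ : ℕ∞) : WithTop ℕ∞) φ → HasCompactSupport φ →
      tsupport φ ⊆ Ioo (0 : ℝ) 1 →
        ∫ t, extendK K t * deriv φ t ∂volI = -∫ t, g t * φ t ∂volI

/-- The Sobolev space `W^{1,2}(I)`. Each of its elements is represented by its unique continuous
representative on `[0, 1]`. -/
def W12 : Set C(Icc (0 : ℝ) 1, ℝ) := {K | ∃ g, HasWeakDeriv K g}

/-- `X = {K ∈ W^{1,2}(I) : K(0) = 0}`. -/
def X : Set C(Icc (0 : ℝ) 1, ℝ) := {K | K ∈ W12 ∧ extendK K 0 = 0}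

/-- `X̃ = {K ∈ X : K ∈ (-π/2, 0] on [0, 1)}`. -/
def Xtilde : Set C(Icc (0 : ℝ) 1, ℝ) :=
  {K | K ∈ X ∧ ∀ t ∈ Ico (0 : ℝ) 1, extendK K t ∈ Ioc (-(Real.pi / 2)) 0}

/-- `F(t) = ∫_t^1 f(s) ds` for a force `f : I → ℝ²`, where `ℝ²` is identified with `ℂ`. -/
def primitive (f : ℝ → ℂ) (t : ℝ) : ℂ := ∫ s in t..1, f s

/-- `K ∈ X` solves `(A K')' = -i e^{iK} · F` in the dual `X'` of `X`, that is,
`∫_I A K' φ' - ∫_I (F · i e^{iK}) φ = 0` for every `φ ∈ X`. -/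
def SolvesState (f : ℝ → ℂ) (A : ℝ → ℝ) (K : C(Icc (0 : ℝ) 1, ℝ)) : Prop :=
  K ∈ X ∧ ∃ g, HasWeakDeriv K g ∧
    ∀ φ ∈ X, ∀ ψ, HasWeakDeriv φ ψ →
      ∫ t, A t * g t * ψ t ∂volI
        - ∫ t, inner ℝ (primitive f t)
            (Complex.I * Complex.exp (Complex.I * (extendK K t : ℂ))) * extendK φ t ∂volI = 0

/-- The coefficient `A(θ) = ((1 - θ)/a + θ/b)⁻¹`. -/
def coeff (a b : ℝ) (θ : ℝ → ℝ) (t : ℝ) : ℝ := ((1 - θ t) / a + θ t / b)⁻¹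

/-- The compliance `J(K, θ) = ∫_I F · e^{iK} + c ∫_I θ`. -/
def J (f : ℝ → ℂ) (c : ℝ) (K : C(Icc (0 : ℝ) 1, ℝ)) (θ : ℝ → ℝ) : ℝ :=
  ∫ t, inner ℝ (primitive f t) (Complex.exp (Complex.I * (extendK K t : ℂ))) ∂volI
    + c * ∫ t, θ t ∂volI

/-- The force `f = -e₂`. -/
def gravity : ℝ → ℂ := fun _ => -Complex.I

/-- The relaxed designs `L^∞(I; [0, 1])`. -/
def relaxedDesigns : Set (Lp ℝ ⊤ volI) := {θ | ∀ᵐ t ∂volI, θ t ∈ Icc (0 : ℝ) 1}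

/-- The classical designs `L^∞(I; {0, 1})`. -/
def classicalDesigns : Set (Lp ℝ ⊤ volI) := {χ | ∀ᵐ t ∂volI, χ t ∈ ({0, 1} : Set ℝ)}

open Classical in
/-- The solution `K(θ) ∈ X̃` of the state equation with `f = -e₂` and `A = A(θ)`
(the value `0` is used only if there is no such solution). -/
def state (a b : ℝ) (θ : Lp ℝ ⊤ volI) : C(Icc (0 : ℝ) 1, ℝ) :=
  if h : ∃ K, K ∈ Xtilde ∧ SolvesState gravity (coeff a b θ) K then h.choose else 0

/-- `Ĵ(θ) = J(K(θ), θ)`, for `f = -e₂`. -/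
def Jhat (a b c : ℝ) (θ : Lp ℝ ⊤ volI) : ℝ := J gravity c (state a b θ) θ

end Beam

end

/-!
The state equation and the compliance depend on a design `θ` only through the primitive
`Θ(t) = ∫_0^t θ`, and continuously so in the uniform norm; both claims on the infimum follow.

*Integrated equation.* On an interval, `W^{1,2}` functions are the primitives of `L²` functions
(`hasWeakDeriv_iff`, from the du Bois-Reymond lemma). Integrating the load term by parts, the weak
equation becomes `K(0) = 0`, `K' = -B M`, where `B = 1 / A(θ) = (1 - θ)/a + θ/b` is affine in `θ`
and `M(s) = ∫_s^1 (1 - r) cos K(r) dr` (`solvesState_iff`).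

*Stability and uniqueness.* Let `K₁`, `K₂` be solutions with values in `[-π/2, 0]`, for `B₁`, `B₂`.
There `cos` is increasing, so testing with `K₁ - K₂` gives
`∫ B₁ (M₁ - M₂)² ≤ -∫ (B₁ - B₂) M₂ (M₁ - M₂)`. Integrating `B₁ - B₂` by parts bounds the right-hand
side by a multiple of `d = sup_t |∫_0^t (B₁ - B₂)|` (`integral_mul_moment_sub_sq_le`), and then
`K₁ - K₂ = -∫ (B₁ M₁ - B₂ M₂)` is uniformly small with `d` (`abs_sub_le_of_isEquilibrium`). The case
`B₁ = B₂` is uniqueness.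

*Existence* is by shooting from the free end `t = 1`. With `β = ∫_0^t B` and `L = K + β M` the
equation turns into an ordinary differential equation for `(L, M)` with continuous coefficients, to
which the Picard-Lindelöf theorem applies although `B` is only measurable
(`exists_isEquilibrium`).

*The infimum.* The primitives `Θ` form a compact subset of `C([0, 1])` by Arzelà-Ascoli
(`isCompact_massFunctions`), so the minimum is attained. Distributing the same mass bang-bang on
small cells approximates `Θ` uniformly by primitives of classical designs
(`exists_classical_approx`), so the infimum over classical designs is the same.
-/

namespace Beam

/-! ### Primitives and integration by parts -/

/-- On `[p, q]` the function `U` is a primitive of the integrable function `u`, in the sense of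
Lebesgue: `U` is absolutely continuous there with `U' = u` almost everywhere. -/
structure HasPrimitive (u U : ℝ → ℝ) (p q : ℝ) : Prop where
  integrable : IntervalIntegrable u volume p q
  eq_add : ∀ t ∈ Icc p q, U t = U p + ∫ s in p..t, u s

namespace HasPrimitive

variable {u v U V : ℝ → ℝ} {p q : ℝ}

lemma absolutelyContinuous_const (C p q : ℝ) :
    AbsolutelyContinuousOnInterval (fun _ : ℝ => C) p q :=
  (LipschitzWith.const C).lipschitzOnWith.absolutelyContinuousOnInterval

lemma integrable_mono (h : HasPrimitive u U p q) {s t : ℝ} (hs : s ∈ Icc p q)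
    (ht : t ∈ Icc p q) : IntervalIntegrable u volume s t :=
  h.integrable.mono_set (uIcc_subset_uIcc (Icc_subset_uIcc hs) (Icc_subset_uIcc ht))

lemma sub_eq (h : HasPrimitive u U p q) {s t : ℝ} (hs : s ∈ Icc p q)
    (ht : t ∈ Icc p q) : U t - U s = ∫ r in s..t, u r := by
  have hpq : p ≤ q := hs.1.trans hs.2
  have hp : p ∈ Icc p q := left_mem_Icc.2 hpq
  rw [h.eq_add t ht, h.eq_add s hs, add_sub_add_left_eq_sub,
    intervalIntegral.integral_interval_sub_left (h.integrable_mono hp ht)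
      (h.integrable_mono hp hs)]

lemma mono (h : HasPrimitive u U p q) {s t : ℝ} (hs : s ∈ Icc p q)
    (ht : t ∈ Icc p q) : HasPrimitive u U s t :=
  ⟨h.integrable_mono hs ht, fun r hr => by
    rw [← h.sub_eq hs ⟨hs.1.trans hr.1, hr.2.trans ht.2⟩]; ring⟩

lemma congr_fun (h : HasPrimitive u U p q) (hpq : p ≤ q) (hV : EqOn U V (Icc p q)) :
    HasPrimitive u V p q :=
  ⟨h.integrable, fun t ht => by rw [← hV ht, ← hV (left_mem_Icc.2 hpq), ← h.eq_add t ht]⟩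

lemma congr_deriv (h : HasPrimitive u U p q) (hpq : p ≤ q) (hv : EqOn u v (Icc p q)) :
    HasPrimitive v U p q := by
  rw [← uIcc_of_le hpq] at hv
  refine ⟨(intervalIntegrable_congr (hv.mono uIoc_subset_uIcc)).1 h.integrable, fun t ht => ?_⟩
  rw [h.eq_add t ht, intervalIntegral.integral_congr (hv.mono
    (uIcc_subset_uIcc left_mem_uIcc (Icc_subset_uIcc ht)))]

lemma integral (hu : IntervalIntegrable u volume p q) (C : ℝ) :
    HasPrimitive u (fun t => C + ∫ s in p..t, u s) p q :=
  ⟨hu, fun t _ => by simp⟩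

/-- A primitive, extended by the same integral formula, is absolutely continuous. -/
lemma absolutelyContinuous (h : HasPrimitive u U p q) (hpq : p ≤ q) :
    AbsolutelyContinuousOnInterval (fun t => U p + ∫ s in p..t, u s) p q :=
  (absolutelyContinuous_const _ _ _).add
    (h.integrable.absolutelyContinuousOnInterval_intervalIntegral
      (Icc_subset_uIcc (left_mem_Icc.2 hpq)))

lemma continuousOn (h : HasPrimitive u U p q) (hpq : p ≤ q) : ContinuousOn U (Icc p q) := by
  have := (h.absolutelyContinuous hpq).continuousOn
  rw [uIcc_of_le hpq] at this
  exact this.congr fun t ht => h.eq_add t ht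

lemma ae_deriv (h : HasPrimitive u U p q) (hpq : p ≤ q) :
    ∀ᵐ x, x ∈ uIoc p q → deriv (fun t => U p + ∫ s in p..t, u s) x = u x := by
  filter_upwards [h.integrable.ae_hasDerivAt_integral] with x hx hx'
  exact ((hx (uIoc_subset_uIcc hx') p (Icc_subset_uIcc (left_mem_Icc.2 hpq))).const_add
    (U p)).deriv

/-- Integration by parts. -/
lemma integral_mul (hU : HasPrimitive u U p q) (hV : HasPrimitive v V p q) (hpq : p ≤ q) :
    ∫ t in p..q, (u t * V t + U t * v t) = U q * V q - U p * V p := by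
  have key := (hU.absolutelyContinuous hpq).integral_deriv_mul_eq_sub (hV.absolutelyContinuous hpq)
  have hp := left_mem_Icc.2 hpq
  have hq := right_mem_Icc.2 hpq
  simp only [← hU.eq_add q hq, ← hV.eq_add q hq, ← hU.eq_add p hp, ← hV.eq_add p hp] at key
  rw [← key]
  refine intervalIntegral.integral_congr_ae ?_
  filter_upwards [hU.ae_deriv hpq, hV.ae_deriv hpq] with x h1 h2 hx
  have hx' : x ∈ Icc p q := by
    have := uIoc_subset_uIcc hx
    rwa [uIcc_of_le hpq] at this
  rw [h1 hx, h2 hx, ← hU.eq_add x hx', ← hV.eq_add x hx']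

lemma mul (hU : HasPrimitive u U p q) (hV : HasPrimitive v V p q) (hpq : p ≤ q) :
    HasPrimitive (fun t => u t * V t + U t * v t) (fun t => U t * V t) p q := by
  have hUc := hU.continuousOn hpq
  have hVc := hV.continuousOn hpq
  rw [← uIcc_of_le hpq] at hUc hVc
  refine ⟨(hU.integrable.mul_continuousOn hVc).add (hV.integrable.continuousOn_mul hUc),
    fun t ht => ?_⟩
  rw [(hU.mono (left_mem_Icc.2 hpq) ht).integral_mul (hV.mono (left_mem_Icc.2 hpq) ht) ht.1]
  ring

lemma sub (hU : HasPrimitive u U p q) (hV : HasPrimitive v V p q) :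
    HasPrimitive (fun t => u t - v t) (fun t => U t - V t) p q := by
  refine ⟨hU.integrable.sub hV.integrable, fun t ht => ?_⟩
  have hp : p ∈ Icc p q := left_mem_Icc.2 (ht.1.trans ht.2)
  rw [intervalIntegral.integral_sub (hU.integrable_mono hp ht) (hV.integrable_mono hp ht),
    hU.eq_add t ht, hV.eq_add t ht]
  ring

lemma of_hasDerivAt (hpq : p ≤ q) (hU : ∀ t ∈ Icc p q, HasDerivWithinAt U (u t) (Icc p q) t)
    (hu : ContinuousOn u (Icc p q)) : HasPrimitive u U p q := by
  refine ⟨(hu.mono (uIcc_of_le hpq).subset).intervalIntegrable, fun t ht => ?_⟩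
  rw [intervalIntegral.integral_eq_sub_of_hasDeriv_right_of_le ht.1
    (f := U) (f' := u)]
  · ring
  · exact fun s hs => ((hU s ⟨hs.1, hs.2.trans ht.2⟩).continuousWithinAt).mono
      (Icc_subset_Icc_right ht.2)
  · intro s hs
    have hs' : s ∈ Icc p q := ⟨hs.1.le, hs.2.le.trans ht.2⟩
    refine ((hU s hs').hasDerivAt (Icc_mem_nhds hs.1 (hs.2.trans_le ht.2))).hasDerivWithinAt
  · exact ContinuousOn.intervalIntegrable
      (hu.mono (by rw [uIcc_of_le ht.1]; exact Icc_subset_Icc_right ht.2))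

end HasPrimitive

/-! ### Weak derivatives on the interval -/

lemma integral_volI (f : ℝ → ℝ) : ∫ t, f t ∂volI = ∫ t in (0 : ℝ)..1, f t := by
  rw [intervalIntegral.integral_of_le zero_le_one, integral_Ioc_eq_integral_Ioo]

lemma integrable_volI_iff {f : ℝ → ℝ} :
    Integrable f volI ↔ IntervalIntegrable f volume 0 1 :=
  (intervalIntegrable_iff_integrableOn_Ioo_of_le zero_le_one).symm

lemma continuous_extendK (K : C(Icc (0 : ℝ) 1, ℝ)) : Continuous (extendK K) :=
  K.continuous.Icc_extend'

lemma intervalIntegrable_of_memLp {g : ℝ → ℝ} (hg : MemLp g 2 volI) :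
    IntervalIntegrable g volume 0 1 :=
  integrable_volI_iff.1 (hg.integrable one_le_two)

/-- The test functions of the weak derivative, `C_c^∞(I)`. -/
structure IsTest (φ : ℝ → ℝ) : Prop where
  contDiff : ContDiff ℝ ((⊤ : ℕ∞) : WithTop ℕ∞) φ
  hasCompactSupport : HasCompactSupport φ
  tsupport_subset : tsupport φ ⊆ Ioo (0 : ℝ) 1

namespace IsTest

variable {φ ψ : ℝ → ℝ}

lemma eq_zero (h : IsTest φ) {t : ℝ} (ht : t ∉ Ioo (0 : ℝ) 1) : φ t = 0 :=
  image_eq_zero_of_notMem_tsupport fun h' => ht (h.tsupport_subset h')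

lemma continuous (h : IsTest φ) : Continuous φ := h.contDiff.continuous

lemma hasPrimitive (h : IsTest φ) : HasPrimitive (deriv φ) φ 0 1 :=
  HasPrimitive.of_hasDerivAt zero_le_one
    (fun t _ => ((h.contDiff.differentiable (by simp)) t).hasDerivAt.hasDerivWithinAt)
    (h.contDiff.continuous_deriv (by simp)).continuousOn

/-- Integration by parts against a test function: no boundary terms. -/
lemma integral_mul_deriv (h : IsTest φ) {u U : ℝ → ℝ} (hU : HasPrimitive u U 0 1) :
    ∫ t, U t * deriv φ t ∂volI = -∫ t, u t * φ t ∂volI := by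
  have key := hU.integral_mul h.hasPrimitive zero_le_one
  have hUc := hU.continuousOn zero_le_one
  rw [← uIcc_of_le (zero_le_one' ℝ)] at hUc
  rw [intervalIntegral.integral_add (hU.integrable.mul_continuousOn h.continuous.continuousOn)
    (h.hasPrimitive.integrable.continuousOn_mul hUc), h.eq_zero (by simp), h.eq_zero (by simp)]
    at key
  rw [integral_volI, integral_volI]
  linarith

/-- A test function of vanishing mean is the derivative of a test function. -/
lemma primitive (h : IsTest φ) (h0 : ∫ t in (0 : ℝ)..1, φ t = 0) :
    IsTest (fun t => ∫ s in (0 : ℝ)..t, φ s) ∧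
      deriv (fun t => ∫ s in (0 : ℝ)..t, φ s) = φ := by
  have hd : ∀ t, HasDerivAt (fun t => ∫ s in (0 : ℝ)..t, φ s) (φ t) t := fun t =>
    h.continuous.integral_hasStrictDerivAt 0 t |>.hasDerivAt
  have hderiv : deriv (fun t => ∫ s in (0 : ℝ)..t, φ s) = φ := funext fun t => (hd t).deriv
  have hc : IsCompact (tsupport φ ∪ {1 / 2}) :=
    h.hasCompactSupport.isCompact.union isCompact_singleton
  have hne : (tsupport φ ∪ {(1 / 2 : ℝ)}).Nonempty := ⟨1 / 2, by simp⟩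
  have hsub : tsupport φ ∪ {(1 / 2 : ℝ)} ⊆ Ioo 0 1 :=
    union_subset h.tsupport_subset (by intro x hx; rw [mem_singleton_iff] at hx; norm_num [hx])
  obtain ⟨α, hα, hα'⟩ := hc.exists_isLeast hne
  obtain ⟨β, hβ, hβ'⟩ := hc.exists_isGreatest hne
  have hz : ∀ t, t ∉ Icc α β → φ t = 0 := fun t ht =>
    image_eq_zero_of_notMem_tsupport fun h' => ht ⟨hα' (Or.inl h'), hβ' (Or.inl h')⟩
  have hI : ∀ s t : ℝ, IntervalIntegrable φ volume s t := h.continuous.intervalIntegrable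
  have hsupp : Function.support (fun t => ∫ s in (0 : ℝ)..t, φ s) ⊆ Icc α β := by
    intro t ht
    by_contra hn
    apply ht
    rcases not_and_or.1 hn with h1 | h1
    · push Not at h1
      refine intervalIntegral.integral_zero_ae (Filter.Eventually.of_forall fun s hs => hz s ?_)
      intro hs'
      have hα0 := (hsub hα).1
      rcases (uIoc_subset_uIcc hs) with ⟨_, h3⟩
      exact absurd (hs'.1.trans h3) (not_le.2 (max_lt hα0 h1))
    · push Not at h1
      change ∫ s in (0 : ℝ)..t, φ s = 0
      rw [← intervalIntegral.integral_add_adjacent_intervals (hI 0 1) (hI 1 t), h0, zero_add]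
      refine intervalIntegral.integral_zero_ae (Filter.Eventually.of_forall fun s hs => hz s ?_)
      intro hs'
      have hβ1 := (hsub hβ).2
      rcases (uIoc_subset_uIcc hs) with ⟨h3, _⟩
      exact absurd (h3.trans hs'.2) (not_le.2 (lt_min hβ1 h1))
  have hts : tsupport (fun t => ∫ s in (0 : ℝ)..t, φ s) ⊆ Icc α β :=
    closure_minimal hsupp isClosed_Icc
  refine ⟨⟨?_, HasCompactSupport.of_support_subset_isCompact isCompact_Icc hsupp, hts.trans ?_⟩,
    hderiv⟩
  · rw [contDiff_infty_iff_deriv, hderiv]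
    exact ⟨fun t => (hd t).differentiableAt, h.contDiff⟩
  · exact Icc_subset_Ioo (hsub hα).1 (hsub hβ).2

lemma sub_const_mul (hφ : IsTest φ) (hψ : IsTest ψ) (c : ℝ) :
    IsTest (fun t => φ t - c * ψ t) := by
  have hs : Function.support (fun t => φ t - c * ψ t) ⊆ tsupport φ ∪ tsupport ψ := by
    intro t ht
    by_contra hn
    rw [mem_union, not_or] at hn
    apply ht
    simp [image_eq_zero_of_notMem_tsupport hn.1, image_eq_zero_of_notMem_tsupport hn.2]
  exact ⟨hφ.contDiff.sub (contDiff_const.mul hψ.contDiff),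
    HasCompactSupport.of_support_subset_isCompact
      (hφ.hasCompactSupport.isCompact.union hψ.hasCompactSupport.isCompact) hs,
    (closure_minimal hs ((isClosed_tsupport _).union (isClosed_tsupport _))).trans
      (union_subset hφ.tsupport_subset hψ.tsupport_subset)⟩

end IsTest

lemma exists_isTest_integral_eq_one :
    ∃ ρ, IsTest ρ ∧ ∫ t in (0 : ℝ)..1, ρ t = 1 := by
  let b : ContDiffBump (1 / 2 : ℝ) := ⟨1 / 8, 1 / 4, by norm_num, by norm_num⟩
  have ht : IsTest (b.normed volume) := by
    refine ⟨b.contDiff_normed, b.hasCompactSupport_normed, ?_⟩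
    rw [b.tsupport_normed_eq, Real.closedBall_eq_Icc]
    exact Icc_subset_Ioo (by norm_num [b]) (by norm_num [b])
  refine ⟨_, ht, ?_⟩
  rw [← integral_volI, setIntegral_eq_integral_of_forall_compl_eq_zero fun t => ht.eq_zero,
    b.integral_normed]

/-- The fundamental lemma of the calculus of variations on `I`. -/
lemma ae_eq_zero_of_integral_test {f : ℝ → ℝ} (hf : Integrable f volI)
    (h : ∀ ψ, IsTest ψ → ∫ t, f t * ψ t ∂volI = 0) : ∀ᵐ t ∂volI, f t = 0 := by
  rw [ae_restrict_iff' measurableSet_Ioo]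
  refine isOpen_Ioo.ae_eq_zero_of_integral_contDiff_smul_eq_zero
    (IntegrableOn.locallyIntegrableOn hf) fun ψ h1 h2 h3 => ?_
  have ht : IsTest ψ := ⟨h1, h2, h3⟩
  rw [← h ψ ht, setIntegral_eq_integral_of_forall_compl_eq_zero fun t h' => by
    rw [ht.eq_zero h', mul_zero]]
  simp only [smul_eq_mul, mul_comm]

/-- The du Bois-Reymond lemma: a continuous function with vanishing weak derivative is constant. -/
lemma eq_const_of_integral_mul_deriv {w : ℝ → ℝ} (hw : ContinuousOn w (Icc 0 1))
    (h : ∀ φ, IsTest φ → ∫ t, w t * deriv φ t ∂volI = 0) : ∀ t ∈ Icc (0 : ℝ) 1, w t = w 0 := by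
  obtain ⟨ρ, hρ, hρ1⟩ := exists_isTest_integral_eq_one
  have hw' : ContinuousOn w (uIcc 0 1) := by rwa [uIcc_of_le zero_le_one]
  set c := ∫ t in (0 : ℝ)..1, w t * ρ t with hc
  have hae : ∀ᵐ t ∂volI, w t - c = 0 := by
    refine ae_eq_zero_of_integral_test
      (integrable_volI_iff.2 (hw'.sub continuousOn_const).intervalIntegrable) fun ψ hψ => ?_
    -- `ψ` minus a multiple of `ρ` of the same mean is the derivative of a test function.
    have hη := hψ.sub_const_mul hρ (∫ t in (0 : ℝ)..1, ψ t)
    have hη0 : ∫ t in (0 : ℝ)..1, (ψ t - (∫ t in (0 : ℝ)..1, ψ t) * ρ t) = 0 := by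
      rw [intervalIntegral.integral_sub (hψ.continuous.intervalIntegrable _ _)
        ((hρ.continuous.intervalIntegrable _ _).const_mul _),
        intervalIntegral.integral_const_mul, hρ1]
      ring
    obtain ⟨h1, h2⟩ := hη.primitive hη0
    have h3 := h _ h1
    rw [h2, integral_volI] at h3
    have hwψ : IntervalIntegrable (fun t => w t * ψ t) volume 0 1 :=
      (hw'.mul hψ.continuous.continuousOn).intervalIntegrable
    have hwρ : IntervalIntegrable (fun t => w t * ρ t) volume 0 1 :=
      (hw'.mul hρ.continuous.continuousOn).intervalIntegrable
    have h4 : ∫ t in (0 : ℝ)..1, w t * (ψ t - (∫ t in (0 : ℝ)..1, ψ t) * ρ t)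
        = (∫ t in (0 : ℝ)..1, w t * ψ t) - (∫ t in (0 : ℝ)..1, ψ t) * c := by
      rw [hc, ← intervalIntegral.integral_const_mul, ← intervalIntegral.integral_sub hwψ
        (hwρ.const_mul _)]
      congr 1; ext t; ring
    have h5 : ∫ t in (0 : ℝ)..1, (w t - c) * ψ t
        = (∫ t in (0 : ℝ)..1, w t * ψ t) - c * (∫ t in (0 : ℝ)..1, ψ t) := by
      rw [← intervalIntegral.integral_const_mul, ← intervalIntegral.integral_sub hwψ
        ((hψ.continuous.intervalIntegrable _ _).const_mul _)]
      congr 1; ext t; ring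
    rw [integral_volI, h5]
    linarith
  have heq : EqOn w (fun _ => c) (Icc 0 1) := by
    refine Measure.eqOn_Icc_of_ae_eq volume zero_ne_one ?_ hw continuousOn_const
    rw [Measure.restrict_congr_set Ioo_ae_eq_Icc.symm]
    filter_upwards [hae] with t ht
    linarith
  intro t ht
  rw [heq ht, heq (left_mem_Icc.2 zero_le_one)]

/-- On the interval, having the weak derivative `g` means being a primitive of `g ∈ L²`. -/
lemma hasWeakDeriv_iff {K : C(Icc (0 : ℝ) 1, ℝ)} {g : ℝ → ℝ} :
    HasWeakDeriv K g ↔ MemLp g 2 volI ∧ HasPrimitive g (extendK K) 0 1 := by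
  refine ⟨fun ⟨hg, h⟩ => ⟨hg, ?_⟩, fun ⟨hg, h⟩ =>
    ⟨hg, fun φ h1 h2 h3 => IsTest.integral_mul_deriv ⟨h1, h2, h3⟩ h⟩⟩
  have hgi := intervalIntegrable_of_memLp hg
  have hG := HasPrimitive.integral hgi 0
  have hGc := hG.continuousOn zero_le_one
  have hKc := (continuous_extendK K).continuousOn (s := Icc (0 : ℝ) 1)
  refine ⟨hgi, fun t ht => ?_⟩
  have := eq_const_of_integral_mul_deriv (hKc.sub hGc) (fun φ hφ => ?_) t ht
  · simp only [Pi.sub_apply, intervalIntegral.integral_same] at this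
    linarith
  have e1 := h φ hφ.contDiff hφ.hasCompactSupport hφ.tsupport_subset
  have e2 := hφ.integral_mul_deriv hG
  have hd : ContinuousOn (deriv φ) (uIcc 0 1) :=
    (hφ.contDiff.continuous_deriv (by simp)).continuousOn
  simp only [Pi.sub_apply, sub_mul]
  rw [integral_sub, e1, e2, sub_self]
  · exact integrable_volI_iff.2
      (((continuous_extendK K).continuousOn.mul hd).intervalIntegrable)
  · rw [← uIcc_of_le (zero_le_one' ℝ)] at hGc
    exact integrable_volI_iff.2 ((hGc.mul hd).intervalIntegrable)

/-! ### The integrated state equation -/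

lemma primitive_gravity (t : ℝ) : primitive gravity t = -((1 - t : ℝ) : ℂ) * Complex.I := by
  simp only [primitive, gravity, intervalIntegral.integral_const, Complex.real_smul]
  ring

lemma inner_gravity_I_mul_exp (t x : ℝ) :
    inner ℝ (primitive gravity t) (Complex.I * Complex.exp (Complex.I * (x : ℂ)))
      = -((1 - t) * Real.cos x) := by
  rw [primitive_gravity, mul_comm Complex.I (x : ℂ), Complex.exp_mul_I, ← Complex.ofReal_cos,
    ← Complex.ofReal_sin, Complex.inner]
  simp
  rw [Complex.cos_ofReal_re]
  ring

lemma inner_gravity_exp (t x : ℝ) :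
    inner ℝ (primitive gravity t) (Complex.exp (Complex.I * (x : ℂ)))
      = -((1 - t) * Real.sin x) := by
  rw [primitive_gravity, mul_comm Complex.I (x : ℂ), Complex.exp_mul_I, ← Complex.ofReal_cos,
    ← Complex.ofReal_sin, Complex.inner]
  simp
  rw [Complex.sin_ofReal_re]
  ring

/-- The bending moment (up to sign) that the load exerts on the section at `s` of the rod whose
tangent has angle `K`. -/
noncomputable def moment (K : ℝ → ℝ) (s : ℝ) : ℝ := ∫ r in s..1, (1 - r) * Real.cos (K r)

section moment

variable {K : ℝ → ℝ}

@[simp] lemma moment_one : moment K 1 = 0 := by simp [moment]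

lemma hasPrimitive_moment (hK : Continuous K) (p q : ℝ) :
    HasPrimitive (fun t => -((1 - t) * Real.cos (K t))) (moment K) p q := by
  have hc : Continuous fun t => (1 - t) * Real.cos (K t) := by fun_prop
  have hi : ∀ s t : ℝ, IntervalIntegrable (fun t => (1 - t) * Real.cos (K t)) volume s t :=
    hc.intervalIntegrable
  refine ⟨(hi _ _).neg, fun t _ => ?_⟩
  rw [intervalIntegral.integral_neg, moment, moment,
    ← intervalIntegral.integral_add_adjacent_intervals (hi p t) (hi t 1)]
  ring

lemma continuous_moment (hK : Continuous K) : Continuous (moment K) := by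
  have hc : Continuous fun t => (1 - t) * Real.cos (K t) := by fun_prop
  have : moment K = fun s => -∫ r in (1 : ℝ)..s, (1 - r) * Real.cos (K r) := by
    funext s
    rw [moment, intervalIntegral.integral_symm]
  rw [this]
  exact (intervalIntegral.continuous_primitive (fun s t => hc.intervalIntegrable s t) 1).neg

lemma abs_moment_le {s : ℝ} (hs : s ∈ Icc (0 : ℝ) 1) : |moment K s| ≤ 1 := by
  have := intervalIntegral.norm_integral_le_of_norm_le_const (a := s) (b := 1) (C := 1)
    (f := fun r => (1 - r) * Real.cos (K r)) (fun r hr => by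
      rw [uIoc_of_le hs.2] at hr
      rw [Real.norm_eq_abs, abs_mul]
      exact mul_le_one₀ (abs_le.2 ⟨by linarith [hr.2], by linarith [hr.1, hs.1]⟩) (abs_nonneg _)
        (Real.abs_cos_le_one _))
  rw [Real.norm_eq_abs, abs_of_nonneg (sub_nonneg.2 hs.2)] at this
  exact this.trans (by linarith [hs.1])

end moment

/-- `B` is a measurable flexibility, bounded by `Λ`. -/
structure IsFlexibility (B : ℝ → ℝ) (Λ : ℝ) : Prop where
  measurable : Measurable B
  nonneg : ∀ t, 0 ≤ B t
  le : ∀ t, B t ≤ Λ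

namespace IsFlexibility

variable {B : ℝ → ℝ} {Λ : ℝ}

lemma norm_le (hB : IsFlexibility B Λ) (t : ℝ) : ‖B t‖ ≤ Λ := by
  rw [Real.norm_eq_abs, abs_of_nonneg (hB.nonneg t)]
  exact hB.le t

lemma intervalIntegrable (hB : IsFlexibility B Λ) (p q : ℝ) :
    IntervalIntegrable B volume p q := by
  rw [intervalIntegrable_iff]
  exact Measure.integrableOn_of_bounded (M := Λ) (by simp) hB.measurable.aestronglyMeasurable
    (Filter.Eventually.of_forall hB.norm_le)

lemma hasPrimitive (hB : IsFlexibility B Λ) :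
    HasPrimitive B (fun t => ∫ s in (0 : ℝ)..t, B s) 0 1 := by
  simpa using HasPrimitive.integral (hB.intervalIntegrable 0 1) 0

lemma intervalIntegrable_mul (hB : IsFlexibility B Λ) {M : ℝ → ℝ} (hM : Continuous M) (p q : ℝ) :
    IntervalIntegrable (fun t => B t * M t) volume p q :=
  (hB.intervalIntegrable p q).mul_continuousOn hM.continuousOn

end IsFlexibility

/-- The integrated state equation with flexibility `B = 1 / A`: `K(0) = 0` and
`K' = -B M` with `M` the moment of `K`. -/
structure IsEquilibrium (B K : ℝ → ℝ) : Prop where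
  hasPrimitive : HasPrimitive (fun t => -(B t * moment K t)) K 0 1
  zero : K 0 = 0

lemma integral_load_mul {K φ ψ : ℝ → ℝ} (hK : Continuous K) (hφ : HasPrimitive ψ φ 0 1)
    (h0 : φ 0 = 0) :
    ∫ t, inner ℝ (primitive gravity t)
            (Complex.I * Complex.exp (Complex.I * (K t : ℂ))) * φ t ∂volI
      = -∫ t, moment K t * ψ t ∂volI := by
  have key := (hasPrimitive_moment hK 0 1).integral_mul hφ zero_le_one
  have hφc := hφ.continuousOn zero_le_one
  rw [← uIcc_of_le (zero_le_one' ℝ)] at hφc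
  rw [intervalIntegral.integral_add
    ((hasPrimitive_moment hK 0 1).integrable.mul_continuousOn hφc)
    (hφ.integrable.continuousOn_mul (continuous_moment hK).continuousOn), moment_one, h0] at key
  simp only [inner_gravity_I_mul_exp]
  rw [integral_volI, integral_volI]
  linarith

lemma exists_extendK_eqOn {U : ℝ → ℝ} (hU : ContinuousOn U (Icc 0 1)) :
    ∃ K : C(Icc (0 : ℝ) 1, ℝ), EqOn U (extendK K) (Icc 0 1) :=
  ⟨⟨_, hU.domRestrict⟩, fun t ht => by rw [extendK, IccExtend_of_mem _ _ ht]; rfl⟩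

/-- The weak state equation for `A = 1 / B` is the integrated state equation for `B`: integrating
the load term by parts turns the weak equation into `∫_I (A K' + M) φ' = 0` for every `φ ∈ X`, and
the derivatives `φ'` exhaust `L²(I)`. -/
lemma solvesState_iff {A B : ℝ → ℝ} {m Λ : ℝ} (hm : 0 < m) (hmB : ∀ t, m ≤ B t)
    (hB : IsFlexibility B Λ) (hA : ∀ᵐ t ∂volI, A t = (B t)⁻¹) (K : C(Icc (0 : ℝ) 1, ℝ)) :
    SolvesState gravity A K ↔ IsEquilibrium B (extendK K) := by
  have hKc := continuous_extendK K
  have hMc := continuous_moment hKc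
  have hBpos : ∀ t, 0 < B t := fun t => hm.trans_le (hmB t)
  constructor
  · rintro ⟨⟨-, hK0⟩, g, hg, h⟩
    obtain ⟨hg2, hgK⟩ := hasWeakDeriv_iff.1 hg
    have hgi := hg2.integrable one_le_two
    have hBg : Integrable (fun t => (B t)⁻¹ * g t) volI := by
      refine hgi.bdd_mul (c := m⁻¹) hB.measurable.inv.aestronglyMeasurable
        (Filter.Eventually.of_forall fun t => ?_)
      rw [Real.norm_eq_abs, abs_of_pos (inv_pos.2 (hBpos t))]
      exact inv_anti₀ hm (hmB t)
    have hMi : Integrable (moment (extendK K)) volI :=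
      integrable_volI_iff.2 (hMc.intervalIntegrable _ _)
    have hae : ∀ᵐ t ∂volI, (B t)⁻¹ * g t + moment (extendK K) t = 0 := by
      refine ae_eq_zero_of_integral_test (hBg.add hMi) fun ψ hψ => ?_
      have hP := HasPrimitive.integral (hψ.continuous.intervalIntegrable (μ := volume) 0 1) 0
      obtain ⟨φ, hφ⟩ := exists_extendK_eqOn (hP.continuousOn zero_le_one)
      have hPφ := hP.congr_fun zero_le_one hφ
      have hφ0 : extendK φ 0 = 0 := by rw [← hφ (left_mem_Icc.2 zero_le_one)]; simp
      have hψ2 : MemLp ψ 2 volI :=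
        hψ.continuous.memLp_of_hasCompactSupport hψ.hasCompactSupport
      have hw : HasWeakDeriv φ ψ := hasWeakDeriv_iff.2 ⟨hψ2, hPφ⟩
      have e := h φ ⟨⟨ψ, hw⟩, hφ0⟩ ψ hw
      rw [integral_load_mul hKc hPφ hφ0] at e
      have hcongr : ∫ t, A t * g t * ψ t ∂volI = ∫ t, (B t)⁻¹ * g t * ψ t ∂volI :=
        integral_congr_ae (by filter_upwards [hA] with t ht; rw [ht])
      obtain ⟨C, hC⟩ := hψ.hasCompactSupport.exists_bound_of_continuous hψ.continuous
      have i1 : Integrable (fun t => (B t)⁻¹ * g t * ψ t) volI :=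
        hBg.mul_bdd hψ.continuous.aestronglyMeasurable (Filter.Eventually.of_forall hC)
      have i2 : Integrable (fun t => moment (extendK K) t * ψ t) volI :=
        hMi.mul_bdd hψ.continuous.aestronglyMeasurable (Filter.Eventually.of_forall hC)
      simp only [add_mul]
      rw [integral_add i1 i2, ← hcongr]
      linarith
    refine ⟨⟨(hB.intervalIntegrable_mul hMc _ _).neg, fun t ht => ?_⟩, hK0⟩
    rw [hgK.eq_add t ht]
    congr 1
    refine intervalIntegral.integral_congr_ae_restrict ?_
    have hsub : uIoc 0 t ⊆ Ioc (0 : ℝ) 1 := by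
      rw [uIoc_of_le ht.1]; exact Ioc_subset_Ioc_right ht.2
    refine ae_restrict_of_ae_restrict_of_subset hsub ?_
    rw [Measure.restrict_congr_set Ioo_ae_eq_Ioc.symm]
    filter_upwards [hae] with s hs
    have := (hBpos s).ne'
    field_simp at hs
    linarith
  · rintro ⟨hP, h0⟩
    have hg2 : MemLp (fun t => -(B t * moment (extendK K) t)) 2 volI := by
      refine MemLp.of_bound (hB.measurable.mul hMc.measurable).neg.aestronglyMeasurable Λ ?_
      rw [ae_restrict_iff' measurableSet_Ioo]
      refine Filter.Eventually.of_forall fun t ht => ?_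
      rw [norm_neg, norm_mul]
      have := abs_moment_le (K := extendK K) (Ioo_subset_Icc_self ht)
      calc ‖B t‖ * ‖moment (extendK K) t‖ ≤ Λ * 1 :=
            mul_le_mul (hB.norm_le t) this (norm_nonneg _) ((norm_nonneg _).trans (hB.norm_le t))
        _ = Λ := mul_one _
    have hw := hasWeakDeriv_iff.2 ⟨hg2, hP⟩
    refine ⟨⟨⟨_, hw⟩, h0⟩, _, hw, fun φ hφ ψ hψ => ?_⟩
    rw [integral_load_mul hKc (hasWeakDeriv_iff.1 hψ).2 hφ.2, sub_neg_eq_add]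
    have : ∫ t, A t * -(B t * moment (extendK K) t) * ψ t ∂volI
        = ∫ t, -(moment (extendK K) t * ψ t) ∂volI := by
      refine integral_congr_ae ?_
      filter_upwards [hA] with t ht
      have := (hBpos t).ne'
      rw [ht]
      field_simp
    rw [this, integral_neg, neg_add_cancel]

/-! ### Stability and uniqueness -/

lemma abs_integral_le_of_le {f : ℝ → ℝ} {C t : ℝ} (hC : 0 ≤ C) (ht : t ∈ Icc (0 : ℝ) 1)
    (h : ∀ s ∈ Icc (0 : ℝ) 1, |f s| ≤ C) : |∫ s in (0 : ℝ)..t, f s| ≤ C := by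
  have := intervalIntegral.norm_integral_le_of_norm_le_const (a := 0) (b := t) (C := C)
    (f := f) (fun s hs => by
      rw [uIoc_of_le ht.1] at hs
      exact h s ⟨hs.1.le, hs.2.trans ht.2⟩)
  rw [Real.norm_eq_abs, sub_zero, abs_of_nonneg ht.1] at this
  exact this.trans (mul_le_of_le_one_right hC ht.2)

lemma cos_sub_mul_sub_nonneg {x y : ℝ} (hx : x ∈ Icc (-(Real.pi / 2)) 0)
    (hy : y ∈ Icc (-(Real.pi / 2)) 0) : 0 ≤ (Real.cos x - Real.cos y) * (x - y) := by
  have mono : ∀ {x y : ℝ}, x ∈ Icc (-(Real.pi / 2)) 0 → y ≤ 0 → x ≤ y →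
      Real.cos x ≤ Real.cos y := fun {x y} hx hy hxy => by
    rw [← Real.cos_neg x, ← Real.cos_neg y]
    exact Real.cos_le_cos_of_nonneg_of_le_pi (by linarith) (by linarith [hx.1, Real.pi_pos])
      (by linarith)
  rcases le_total x y with h | h
  · exact mul_nonneg_of_nonpos_of_nonpos (sub_nonpos.2 (mono hx hy.2 h)) (sub_nonpos.2 h)
  · exact mul_nonneg (sub_nonneg.2 (mono hy hx.2 h)) (sub_nonneg.2 h)

section stability

variable {B₁ B₂ K₁ K₂ : ℝ → ℝ} {Λ d : ℝ}

/-- The energy estimate. Testing the difference of the two equations with `K₁ - K₂` makes the load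
term nonnegative, because `cos` is monotone on `[-π/2, 0]`; in the remaining term `B₁ - B₂` is
integrated by parts, so that only the primitives of `B₁` and `B₂` are compared. -/
lemma integral_mul_moment_sub_sq_le (hB₁ : IsFlexibility B₁ Λ) (hB₂ : IsFlexibility B₂ Λ)
    (hK₁ : Continuous K₁) (hK₂ : Continuous K₂)
    (h₁ : IsEquilibrium B₁ K₁) (h₂ : IsEquilibrium B₂ K₂)
    (hr₁ : ∀ t ∈ Icc (0 : ℝ) 1, K₁ t ∈ Icc (-(Real.pi / 2)) 0)
    (hr₂ : ∀ t ∈ Icc (0 : ℝ) 1, K₂ t ∈ Icc (-(Real.pi / 2)) 0)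
    (hd : ∀ t ∈ Icc (0 : ℝ) 1, |(∫ s in (0 : ℝ)..t, B₁ s) - ∫ s in (0 : ℝ)..t, B₂ s| ≤ d) :
    ∫ t in (0 : ℝ)..1, B₁ t * (moment K₁ t - moment K₂ t) ^ 2 ≤ 4 * d := by
  have hd0 : 0 ≤ d := (abs_nonneg _).trans (hd 0 (left_mem_Icc.2 zero_le_one))
  have hM₁ := continuous_moment hK₁
  have hM₂ := continuous_moment hK₂
  have pM₁ := hasPrimitive_moment hK₁ 0 1
  have pM₂ := hasPrimitive_moment hK₂ 0 1
  have pD := pM₁.sub pM₂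
  have pK := h₁.hasPrimitive.sub h₂.hasPrimitive
  have pb := hB₁.hasPrimitive.sub hB₂.hasPrimitive
  have e₁ := pD.integral_mul pK zero_le_one
  have e₂ := (pb.integral_mul (pM₂.mul pD zero_le_one) zero_le_one)
  simp only [moment_one, h₁.zero, h₂.zero, intervalIntegral.integral_same] at e₁ e₂
  have i₁ : IntervalIntegrable (fun t => B₁ t * (moment K₁ t - moment K₂ t) ^ 2) volume 0 1 :=
    hB₁.intervalIntegrable_mul ((hM₁.sub hM₂).pow 2) 0 1
  have i₂ : IntervalIntegrable (fun t => (B₁ t - B₂ t) * (moment K₂ t *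
      (moment K₁ t - moment K₂ t))) volume 0 1 :=
    ((hB₁.intervalIntegrable 0 1).sub (hB₂.intervalIntegrable 0 1)).mul_continuousOn
      (hM₂.mul (hM₁.sub hM₂)).continuousOn
  have i₃ : IntervalIntegrable (fun t => (1 - t) * ((Real.cos (K₁ t) - Real.cos (K₂ t)) *
      (K₁ t - K₂ t))) volume 0 1 := by
    apply Continuous.intervalIntegrable
    fun_prop
  set E : ℝ → ℝ := fun t => -((1 - t) * Real.cos (K₂ t)) * (moment K₁ t - moment K₂ t) +
      moment K₂ t * (-((1 - t) * Real.cos (K₁ t)) - -((1 - t) * Real.cos (K₂ t))) with hE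
  have hEc : Continuous E := by fun_prop
  have i₄ : IntervalIntegrable (fun t => ((∫ s in (0 : ℝ)..t, B₁ s) - ∫ s in (0 : ℝ)..t, B₂ s)
      * E t) volume 0 1 := by
    have := pb.continuousOn zero_le_one
    rw [← uIcc_of_le (zero_le_one' ℝ)] at this
    exact (this.mul hEc.continuousOn).intervalIntegrable
  have f₁ : (∫ t in (0 : ℝ)..1, B₁ t * (moment K₁ t - moment K₂ t) ^ 2)
      + (∫ t in (0 : ℝ)..1, (B₁ t - B₂ t) * (moment K₂ t * (moment K₁ t - moment K₂ t)))
      + (∫ t in (0 : ℝ)..1, (1 - t) * ((Real.cos (K₁ t) - Real.cos (K₂ t)) * (K₁ t - K₂ t)))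
      = 0 := by
    rw [← intervalIntegral.integral_add i₁ i₂, ← intervalIntegral.integral_add (i₁.add i₂) i₃,
      ← neg_eq_zero, ← intervalIntegral.integral_neg]
    rw [sub_self, zero_mul, mul_zero, sub_zero] at e₁
    rw [← e₁]
    congr 1; ext t; ring
  have f₂ : (∫ t in (0 : ℝ)..1, (B₁ t - B₂ t) * (moment K₂ t * (moment K₁ t - moment K₂ t)))
      + (∫ t in (0 : ℝ)..1, ((∫ s in (0 : ℝ)..t, B₁ s) - ∫ s in (0 : ℝ)..t, B₂ s) * E t)
      = 0 := by
    rw [← intervalIntegral.integral_add i₂ i₄, e₂]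
    ring
  have f₃ : 0 ≤ ∫ t in (0 : ℝ)..1,
      (1 - t) * ((Real.cos (K₁ t) - Real.cos (K₂ t)) * (K₁ t - K₂ t)) :=
    intervalIntegral.integral_nonneg zero_le_one fun t ht =>
      mul_nonneg (by linarith [ht.2]) (cos_sub_mul_sub_nonneg (hr₁ t ht) (hr₂ t ht))
  have f₄ : |∫ t in (0 : ℝ)..1, ((∫ s in (0 : ℝ)..t, B₁ s) - ∫ s in (0 : ℝ)..t, B₂ s) * E t|
      ≤ d * 4 := by
    refine abs_integral_le_of_le (by positivity) (right_mem_Icc.2 zero_le_one) fun t ht => ?_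
    rw [abs_mul]
    refine mul_le_mul (hd t ht) ?_ (abs_nonneg _) hd0
    have b₁ := abs_moment_le (K := K₁) ht
    have b₂ := abs_moment_le (K := K₂) ht
    have b₃ : ∀ x, |-((1 - t) * Real.cos x)| ≤ 1 := fun x => by
      rw [abs_neg, abs_mul]
      exact mul_le_one₀ (abs_le.2 ⟨by linarith [ht.2], by linarith [ht.1]⟩) (abs_nonneg _)
        (Real.abs_cos_le_one _)
    calc |E t| ≤ |-((1 - t) * Real.cos (K₂ t))| * |moment K₁ t - moment K₂ t| +
          |moment K₂ t| * |-((1 - t) * Real.cos (K₁ t)) - -((1 - t) * Real.cos (K₂ t))| := by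
          rw [← abs_mul, ← abs_mul]; exact abs_add_le _ _
      _ ≤ 1 * 2 + 1 * 2 := by
          gcongr
          · exact b₃ _
          · exact (abs_sub _ _).trans (by linarith)
          · exact (abs_sub _ _).trans (by linarith [b₃ (K₁ t), b₃ (K₂ t)])
      _ = 4 := by norm_num
  linarith [(abs_le.1 f₄).1, (abs_le.1 f₄).2]

/-- Two equilibria with values in `[-π/2, 0]` are uniformly close once the primitives of their
flexibilities are. -/
lemma abs_sub_le_of_isEquilibrium (hB₁ : IsFlexibility B₁ Λ) (hB₂ : IsFlexibility B₂ Λ)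
    (hK₁ : Continuous K₁) (hK₂ : Continuous K₂)
    (h₁ : IsEquilibrium B₁ K₁) (h₂ : IsEquilibrium B₂ K₂)
    (hr₁ : ∀ t ∈ Icc (0 : ℝ) 1, K₁ t ∈ Icc (-(Real.pi / 2)) 0)
    (hr₂ : ∀ t ∈ Icc (0 : ℝ) 1, K₂ t ∈ Icc (-(Real.pi / 2)) 0)
    (hd : ∀ t ∈ Icc (0 : ℝ) 1, |(∫ s in (0 : ℝ)..t, B₁ s) - ∫ s in (0 : ℝ)..t, B₂ s| ≤ d)
    {ε : ℝ} (hε : 0 < ε) {t : ℝ} (ht : t ∈ Icc (0 : ℝ) 1) :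
    |K₁ t - K₂ t| ≤ ε * Λ + 4 * d / ε + 2 * d := by
  have hd0 : 0 ≤ d := (abs_nonneg _).trans (hd 0 (left_mem_Icc.2 zero_le_one))
  have hM₁ := continuous_moment hK₁
  have hM₂ := continuous_moment hK₂
  have h0 : (0 : ℝ) ∈ Icc (0 : ℝ) 1 := left_mem_Icc.2 zero_le_one
  have i₁ : ∀ p q, IntervalIntegrable (fun s => B₁ s * (moment K₁ s - moment K₂ s)) volume p q :=
    hB₁.intervalIntegrable_mul (hM₁.sub hM₂)
  have i₂ : IntervalIntegrable (fun s => (B₁ s - B₂ s) * moment K₂ s) volume 0 t :=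
    ((hB₁.intervalIntegrable 0 t).sub (hB₂.intervalIntegrable 0 t)).mul_continuousOn
      hM₂.continuousOn
  have hsplit : K₁ t - K₂ t = -(∫ s in (0 : ℝ)..t, B₁ s * (moment K₁ s - moment K₂ s))
      - ∫ s in (0 : ℝ)..t, (B₁ s - B₂ s) * moment K₂ s := by
    have := (h₁.hasPrimitive.sub h₂.hasPrimitive).eq_add t ht
    rw [h₁.zero, h₂.zero, sub_self, zero_add] at this
    rw [this, ← neg_add', ← intervalIntegral.integral_add (i₁ 0 t) i₂,
      ← intervalIntegral.integral_neg]
    congr 1; ext s; ring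
  have f₁ : |∫ s in (0 : ℝ)..t, B₁ s * (moment K₁ s - moment K₂ s)| ≤ ε * Λ + 4 * d / ε := by
    have i₃ : IntervalIntegrable (fun s => B₁ s * (moment K₁ s - moment K₂ s) ^ 2) volume 0 1 :=
      hB₁.intervalIntegrable_mul ((hM₁.sub hM₂).pow 2) 0 1
    calc |∫ s in (0 : ℝ)..t, B₁ s * (moment K₁ s - moment K₂ s)|
        ≤ ∫ s in (0 : ℝ)..t, |B₁ s * (moment K₁ s - moment K₂ s)| :=
          intervalIntegral.abs_integral_le_integral_abs ht.1
      _ ≤ ∫ s in (0 : ℝ)..1, |B₁ s * (moment K₁ s - moment K₂ s)| :=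
          intervalIntegral.integral_mono_interval le_rfl ht.1 ht.2
            (Filter.Eventually.of_forall fun s => abs_nonneg _) (i₁ 0 1).abs
      _ ≤ ∫ s in (0 : ℝ)..1, (ε * Λ + B₁ s * (moment K₁ s - moment K₂ s) ^ 2 / ε) := by
          refine intervalIntegral.integral_mono_on zero_le_one (i₁ 0 1).abs
            (intervalIntegrable_const.add (i₃.div_const ε)) fun s _ => ?_
          have hB0 := hB₁.nonneg s
          rw [abs_mul, abs_of_nonneg hB0]
          have hy : |moment K₁ s - moment K₂ s| ≤ ε + (moment K₁ s - moment K₂ s) ^ 2 / ε := by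
            rw [← sub_le_iff_le_add', le_div_iff₀ hε, ← sq_abs]
            nlinarith [sq_nonneg (|moment K₁ s - moment K₂ s| - ε),
              mul_nonneg hε.le (abs_nonneg (moment K₁ s - moment K₂ s))]
          calc B₁ s * |moment K₁ s - moment K₂ s|
              ≤ B₁ s * (ε + (moment K₁ s - moment K₂ s) ^ 2 / ε) := by gcongr
            _ = ε * B₁ s + B₁ s * (moment K₁ s - moment K₂ s) ^ 2 / ε := by ring
            _ ≤ ε * Λ + B₁ s * (moment K₁ s - moment K₂ s) ^ 2 / ε := by
                gcongr; exact hB₁.le s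
      _ = ε * Λ + (∫ s in (0 : ℝ)..1, B₁ s * (moment K₁ s - moment K₂ s) ^ 2) / ε := by
          rw [intervalIntegral.integral_add intervalIntegrable_const (i₃.div_const ε),
            intervalIntegral.integral_div]
          simp
      _ ≤ ε * Λ + 4 * d / ε := by
          gcongr
          exact integral_mul_moment_sub_sq_le hB₁ hB₂ hK₁ hK₂ h₁ h₂ hr₁ hr₂ hd
  have f₂ : |∫ s in (0 : ℝ)..t, (B₁ s - B₂ s) * moment K₂ s| ≤ 2 * d := by
    have pb := (hB₁.hasPrimitive.sub hB₂.hasPrimitive).mono h0 ht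
    have e := pb.integral_mul (hasPrimitive_moment hK₂ 0 t) ht.1
    have hbc := pb.continuousOn ht.1
    rw [← uIcc_of_le ht.1] at hbc
    rw [intervalIntegral.integral_add i₂
      ((hasPrimitive_moment hK₂ 0 t).integrable.continuousOn_mul hbc)] at e
    simp only [intervalIntegral.integral_same, sub_self, zero_mul, sub_zero] at e
    have g₁ : |((∫ s in (0 : ℝ)..t, B₁ s) - ∫ s in (0 : ℝ)..t, B₂ s) * moment K₂ t| ≤ d := by
      rw [abs_mul]
      exact (mul_le_mul (hd t ht) (abs_moment_le ht) (abs_nonneg _) hd0).trans_eq (mul_one d)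
    have g₂ : |∫ r in (0 : ℝ)..t, ((∫ s in (0 : ℝ)..r, B₁ s) - ∫ s in (0 : ℝ)..r, B₂ s) *
        -((1 - r) * Real.cos (K₂ r))| ≤ d := by
      refine abs_integral_le_of_le hd0 ht fun r hr => ?_
      rw [abs_mul, abs_neg, abs_mul]
      refine (mul_le_mul (hd r hr) (mul_le_one₀
        (abs_le.2 ⟨by linarith [hr.2], by linarith [hr.1]⟩) (abs_nonneg _)
        (Real.abs_cos_le_one _)) (by positivity) hd0).trans_eq (mul_one d)
    rw [abs_le] at g₁ g₂ ⊢
    constructor <;> linarith [g₁.1, g₁.2, g₂.1, g₂.2]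
  rw [hsplit]
  rw [abs_le] at f₁ f₂ ⊢
  constructor <;> linarith [f₁.1, f₁.2, f₂.1, f₂.2]

lemma IsEquilibrium.eqOn {B : ℝ → ℝ} (hB : IsFlexibility B Λ)
    (hK₁ : Continuous K₁) (hK₂ : Continuous K₂)
    (h₁ : IsEquilibrium B K₁) (h₂ : IsEquilibrium B K₂)
    (hr₁ : ∀ t ∈ Icc (0 : ℝ) 1, K₁ t ∈ Icc (-(Real.pi / 2)) 0)
    (hr₂ : ∀ t ∈ Icc (0 : ℝ) 1, K₂ t ∈ Icc (-(Real.pi / 2)) 0) :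
    EqOn K₁ K₂ (Icc 0 1) := by
  intro t ht
  have hΛ : 0 ≤ Λ := (hB.nonneg 0).trans (hB.le 0)
  have key : ∀ ε > 0, |K₁ t - K₂ t| ≤ ε * Λ := fun ε hε => by
    simpa using abs_sub_le_of_isEquilibrium (d := 0) hB hB hK₁ hK₂ h₁ h₂ hr₁ hr₂ (by simp) hε ht
  rw [← sub_eq_zero, ← abs_nonpos_iff]
  refine le_of_forall_pos_le_add fun δ hδ => ?_
  refine (key (δ / (Λ + 1)) (by positivity)).trans ?_
  rw [zero_add, div_mul_eq_mul_div, div_le_iff₀ (by positivity)]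
  nlinarith

end stability

/-! ### Existence by shooting -/

/-- The cosine of the angle clamped to `[-π/2, 0]`, a globally Lipschitz nonlinearity. -/
noncomputable def clampedCos (x : ℝ) : ℝ := Real.cos (max (-(Real.pi / 2)) (min 0 x))

lemma continuous_clampedCos : Continuous clampedCos := by unfold clampedCos; fun_prop

lemma clampedCos_of_mem {x : ℝ} (hx : x ∈ Icc (-(Real.pi / 2)) 0) :
    clampedCos x = Real.cos x := by
  rw [clampedCos, min_eq_right hx.2, max_eq_right hx.1]

lemma clampedCos_of_le {x : ℝ} (hx : x ≤ -(Real.pi / 2)) : clampedCos x = 0 := by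
  rw [clampedCos, max_eq_left ((min_le_right _ _).trans hx), Real.cos_neg, Real.cos_pi_div_two]

lemma clampedCos_nonneg (x : ℝ) : 0 ≤ clampedCos x :=
  Real.cos_nonneg_of_mem_Icc ⟨le_max_left _ _,
    max_le (by linarith [Real.pi_pos]) ((min_le_left _ _).trans (by linarith [Real.pi_pos]))⟩

lemma abs_clampedCos_sub_le (x y : ℝ) : |clampedCos x - clampedCos y| ≤ |x - y| := by
  refine (Real.abs_cos_sub_cos_le _ _).trans ((abs_max_sub_max_le_max _ _ _ _).trans
    (max_le (by simp) ((abs_min_sub_min_le_max _ _ _ _).trans (max_le (by simp) le_rfl))))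

/-- The vector field of the state equation in the unknowns `L = K + β M` and the moment `M`, where
`β` is the primitive of the flexibility. Unlike `K' = -B M`, the system
`L' = -β (1 - t) cos K`, `M' = -(1 - t) cos K` has continuous coefficients. -/
noncomputable def shootingField (β : ℝ → ℝ) (t : ℝ) (p : ℝ × ℝ) : ℝ × ℝ :=
  (-(β t * ((1 - t) * clampedCos (p.1 - β t * p.2))), -((1 - t) * clampedCos (p.1 - β t * p.2)))

section shooting

variable {β : ℝ → ℝ} {Λ : ℝ}

lemma norm_pair_mul_le {b x Λ : ℝ} (hb : b ∈ Icc 0 Λ) :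
    ‖((-(b * x), -x) : ℝ × ℝ)‖ ≤ (1 + Λ) * |x| := by
  have hΛ : 0 ≤ Λ := hb.1.trans hb.2
  rw [Prod.norm_def, Real.norm_eq_abs, Real.norm_eq_abs, abs_neg, abs_neg, abs_mul,
    abs_of_nonneg hb.1]
  exact max_le (mul_le_mul_of_nonneg_right (by linarith [hb.2]) (abs_nonneg _))
    (le_mul_of_one_le_left (abs_nonneg _) (by linarith))

lemma norm_shootingField_le {t : ℝ} (ht : t ∈ Icc (0 : ℝ) 1) (hβ : β t ∈ Icc 0 Λ) (p : ℝ × ℝ) :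
    ‖shootingField β t p‖ ≤ 1 + Λ := by
  have hΛ : 0 ≤ Λ := hβ.1.trans hβ.2
  refine (norm_pair_mul_le hβ).trans (mul_le_of_le_one_right (by linarith) ?_)
  rw [abs_mul]
  exact mul_le_one₀ (abs_le.2 ⟨by linarith [ht.2], by linarith [ht.1]⟩) (abs_nonneg _)
    (Real.abs_cos_le_one _)

lemma dist_shootingField_le {t : ℝ} (ht : t ∈ Icc (0 : ℝ) 1) (hβ : β t ∈ Icc 0 Λ) (p q : ℝ × ℝ) :
    dist (shootingField β t p) (shootingField β t q) ≤ (1 + Λ) * (1 + Λ) * dist p q := by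
  have hΛ : 0 ≤ Λ := hβ.1.trans hβ.2
  set x := clampedCos (p.1 - β t * p.2)
  set y := clampedCos (q.1 - β t * q.2)
  have e : shootingField β t p - shootingField β t q
      = (-(β t * ((1 - t) * (x - y))), -((1 - t) * (x - y))) := by
    simp only [shootingField, Prod.mk_sub_mk, Prod.mk.injEq]
    constructor <;> ring
  have h₁ : |p.1 - q.1| ≤ dist p q := by rw [dist_eq_norm]; exact norm_fst_le (p - q)
  have h₂ : |p.2 - q.2| ≤ dist p q := by rw [dist_eq_norm]; exact norm_snd_le (p - q)
  rw [dist_eq_norm (shootingField β t p), e, mul_assoc]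
  refine (norm_pair_mul_le hβ).trans (mul_le_mul_of_nonneg_left ?_ (by linarith))
  calc |(1 - t) * (x - y)| ≤ |x - y| := by
        rw [abs_mul]
        exact mul_le_of_le_one_left (abs_nonneg _)
          (abs_le.2 ⟨by linarith [ht.2], by linarith [ht.1]⟩)
    _ ≤ |(p.1 - β t * p.2) - (q.1 - β t * q.2)| := abs_clampedCos_sub_le _ _
    _ = |(p.1 - q.1) - β t * (p.2 - q.2)| := by congr 1; ring
    _ ≤ |p.1 - q.1| + |β t * (p.2 - q.2)| := abs_sub _ _
    _ ≤ dist p q + Λ * dist p q := by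
        rw [abs_mul, abs_of_nonneg hβ.1]
        gcongr
        exact hβ.2
    _ = (1 + Λ) * dist p q := by ring

lemma isPicardLindelof_shootingField (hβc : ContinuousOn β (Icc 0 1)) (hΛ : 0 ≤ Λ)
    (hβ : ∀ t ∈ Icc (0 : ℝ) 1, β t ∈ Icc 0 Λ) (r : NNReal) :
    IsPicardLindelof (shootingField β) (tmin := 0) (tmax := 1) ⟨1, right_mem_Icc.2 zero_le_one⟩ 0
      (r + (1 + Λ.toNNReal)) r (1 + Λ.toNNReal) ((1 + Λ.toNNReal) * (1 + Λ.toNNReal)) where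
  lipschitzOnWith t ht := (LipschitzWith.of_dist_le_mul fun p q => by
    simpa [hΛ] using dist_shootingField_le ht (hβ t ht) p q).lipschitzOnWith
  continuousOn p _ := by
    have h : ContinuousOn (fun t => clampedCos (p.1 - β t * p.2)) (Icc 0 1) :=
      continuous_clampedCos.comp_continuousOn
        (continuousOn_const.sub (hβc.mul continuousOn_const))
    have h' : ContinuousOn (fun t => (1 - t) * clampedCos (p.1 - β t * p.2)) (Icc 0 1) :=
      (continuousOn_const.sub continuousOn_id).mul h
    exact (hβc.mul h').neg.prodMk h'.neg
  norm_le t ht p _ := by simpa [hΛ] using norm_shootingField_le ht (hβ t ht) p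
  mul_max_le := by simp

end shooting

/-- Existence for the state equation by shooting from the free end. The trajectory starting from
`(L, M)(1) = (κ, 0)` satisfies `L(0) ≤ 0` for `κ = -Λ` and `L(0) ≥ 0` for `κ = 0`, and `L(0) = K(0)`
depends continuously on `κ`. At the zero, `κ > -π/2`: the trajectories with `κ ≤ -π/2` are
constant. As `K` is nonincreasing, its values lie in `[κ, 0]`, where the clamping is
not active. -/
theorem exists_isEquilibrium {B : ℝ → ℝ} {Λ : ℝ} (hB : IsFlexibility B Λ) :
    ∃ K : C(Icc (0 : ℝ) 1, ℝ), IsEquilibrium B (extendK K) ∧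
      ∀ t ∈ Icc (0 : ℝ) 1, extendK K t ∈ Ioc (-(Real.pi / 2)) 0 := by
  have hΛ : 0 ≤ Λ := (hB.nonneg 0).trans (hB.le 0)
  set β : ℝ → ℝ := fun t => ∫ s in (0 : ℝ)..t, B s with hβdef
  have pβ : HasPrimitive B β 0 1 := hB.hasPrimitive
  have hβc := pβ.continuousOn zero_le_one
  have hβ : ∀ t ∈ Icc (0 : ℝ) 1, β t ∈ Icc 0 Λ := fun t ht =>
    ⟨intervalIntegral.integral_nonneg ht.1 fun s _ => hB.nonneg s,
      (le_abs_self _).trans (abs_integral_le_of_le hΛ ht fun s _ => hB.norm_le s)⟩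
  have h01 : (0 : ℝ) ∈ Icc (0 : ℝ) 1 := left_mem_Icc.2 zero_le_one
  have h11 : (1 : ℝ) ∈ Icc (0 : ℝ) 1 := right_mem_Icc.2 zero_le_one
  obtain ⟨α, hα, L', hL'⟩ := (isPicardLindelof_shootingField hβc hΛ hβ
    Λ.toNNReal).exists_forall_mem_closedBall_eq_hasDerivWithinAt_lipschitzOnWith
  have hball : ∀ κ ∈ Icc (-Λ) 0, ((κ, 0) : ℝ × ℝ) ∈ Metric.closedBall (0 : ℝ × ℝ) Λ.toNNReal := by
    intro κ hκ
    rw [mem_closedBall_zero_iff, Prod.norm_def, Real.coe_toNNReal _ hΛ]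
    simpa [hΛ] using abs_le.2 ⟨hκ.1, hκ.2.trans hΛ⟩
  -- The angle, the load, and the two equations along the trajectory ending at `(κ, 0)`.
  set U : ℝ → ℝ → ℝ := fun κ t => (α (κ, 0) t).1 - β t * (α (κ, 0) t).2 with hU
  set h : ℝ → ℝ → ℝ := fun κ t => (1 - t) * clampedCos (U κ t) with hh
  have hαc : ∀ κ ∈ Icc (-Λ) 0, ContinuousOn (α (κ, 0)) (Icc 0 1) := fun κ hκ =>
    HasDerivWithinAt.continuousOn (hα _ (hball κ hκ)).2
  have hhc : ∀ κ ∈ Icc (-Λ) 0, ContinuousOn (h κ) (Icc 0 1) := fun κ hκ =>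
    (continuousOn_const.sub continuousOn_id).mul (continuous_clampedCos.comp_continuousOn
      ((hαc κ hκ).fst.sub (hβc.mul (hαc κ hκ).snd)))
  have hh0 : ∀ κ, ∀ t ∈ Icc (0 : ℝ) 1, 0 ≤ h κ t := fun κ t ht =>
    mul_nonneg (by linarith [ht.2]) (clampedCos_nonneg _)
  have hh1 : ∀ κ, ∀ t ∈ Icc (0 : ℝ) 1, |h κ t| ≤ 1 := fun κ t ht => by
    rw [hh, abs_mul]
    exact mul_le_one₀ (abs_le.2 ⟨by linarith [ht.2], by linarith [ht.1]⟩) (abs_nonneg _)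
      (Real.abs_cos_le_one _)
  have pL : ∀ κ ∈ Icc (-Λ) 0,
      HasPrimitive (fun t => -(β t * h κ t)) (fun t => (α (κ, 0) t).1) 0 1 := fun κ hκ =>
    HasPrimitive.of_hasDerivAt zero_le_one
      (fun t ht => ((hα _ (hball κ hκ)).2 t ht).fst) (hβc.mul (hhc κ hκ)).neg
  have pM : ∀ κ ∈ Icc (-Λ) 0,
      HasPrimitive (fun t => -(h κ t)) (fun t => (α (κ, 0) t).2) 0 1 := fun κ hκ =>
    HasPrimitive.of_hasDerivAt zero_le_one
      (fun t ht => ((hα _ (hball κ hκ)).2 t ht).snd) (hhc κ hκ).neg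
  have hα1 : ∀ κ ∈ Icc (-Λ) 0, α (κ, 0) 1 = (κ, 0) := fun κ hκ => (hα _ (hball κ hκ)).1
  have hL0 : ∀ κ ∈ Icc (-Λ) 0, (α (κ, 0) 0).1 = κ + ∫ t in (0 : ℝ)..1, β t * h κ t := by
    intro κ hκ
    have := (pL κ hκ).eq_add 1 h11
    simp only [hα1 κ hκ, intervalIntegral.integral_neg] at this
    linarith
  have hcont : ContinuousOn (fun κ => (α (κ, 0) 0).1) (Icc (-Λ) 0) :=
    (((hL' 0 h01).continuousOn).comp (f := fun κ : ℝ => ((κ, 0) : ℝ × ℝ)) (by fun_prop)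
      hball).fst
  have hΛ0 : -Λ ≤ 0 := by linarith
  have hlow : (α (-Λ, 0) 0).1 ≤ 0 := by
    rw [hL0 _ (left_mem_Icc.2 hΛ0)]
    have := abs_integral_le_of_le (f := fun t => β t * h (-Λ) t) hΛ h11 fun t ht => by
      rw [abs_mul, abs_of_nonneg (hβ t ht).1]
      exact (mul_le_mul (hβ t ht).2 (hh1 _ t ht) (abs_nonneg _) hΛ).trans_eq (mul_one Λ)
    linarith [le_abs_self (∫ t in (0 : ℝ)..1, β t * h (-Λ) t)]
  have hhigh : 0 ≤ (α (0, 0) 0).1 := by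
    rw [hL0 _ (right_mem_Icc.2 hΛ0), zero_add]
    exact intervalIntegral.integral_nonneg zero_le_one fun t ht =>
      mul_nonneg (hβ t ht).1 (hh0 _ t ht)
  obtain ⟨κ, hκ, hκ0⟩ := intermediate_value_Icc hΛ0 hcont ⟨hlow, hhigh⟩
  simp only at hκ0
  set M : ℝ → ℝ := fun t => (α (κ, 0) t).2 with hM
  have hβ0 : β 0 = 0 := by simp [hβdef]
  have pU : HasPrimitive (fun t => -(B t * M t)) (U κ) 0 1 :=
    ((pL κ hκ).sub (pβ.mul (pM κ hκ) zero_le_one)).congr_deriv zero_le_one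
      fun t _ => by simp only [hM]; ring
  have hU0 : U κ 0 = 0 := by simp only [hU, hκ0, hβ0]; ring
  have hU1 : U κ 1 = κ := by simp only [hU, hα1 κ hκ]; ring
  have hMt : ∀ t ∈ Icc (0 : ℝ) 1, M t = ∫ r in t..1, h κ r := by
    intro t ht
    have := (pM κ hκ).sub_eq ht h11
    rw [hα1 κ hκ, intervalIntegral.integral_neg] at this
    simp only [hM]
    linarith
  have hM0 : ∀ t ∈ Icc (0 : ℝ) 1, 0 ≤ M t := fun t ht => by
    rw [hMt t ht]
    exact intervalIntegral.integral_nonneg ht.2 fun s hs => hh0 κ s ⟨ht.1.trans hs.1, hs.2⟩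
  have hanti : ∀ s ∈ Icc (0 : ℝ) 1, ∀ t ∈ Icc (0 : ℝ) 1, s ≤ t → U κ t ≤ U κ s := by
    intro s hs t ht hst
    have := pU.sub_eq hs ht
    rw [intervalIntegral.integral_neg] at this
    have h2 : 0 ≤ ∫ r in s..t, B r * M r := intervalIntegral.integral_nonneg hst fun r hr =>
      mul_nonneg (hB.nonneg r) (hM0 r ⟨hs.1.trans hr.1, hr.2.trans ht.2⟩)
    linarith
  have hκpi : -(Real.pi / 2) < κ := by
    by_contra hcon
    push Not at hcon
    -- By uniqueness the trajectory would be constant.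
    have heq : EqOn (α (κ, 0)) (fun _ => (κ, 0)) (Icc 0 1) := by
      refine ODE_solution_unique_of_mem_Icc_left (v := shootingField β) (s := fun _ => univ)
        (K := (1 + Λ.toNNReal) * (1 + Λ.toNNReal)) (fun t ht => ?_) (hαc κ hκ) (fun t ht => ?_)
        (fun _ _ => mem_univ _) continuousOn_const (fun t ht => ?_) (fun _ _ => mem_univ _)
        (hα1 κ hκ)
      · exact (LipschitzWith.of_dist_le_mul fun p q => by
          simpa [hΛ] using dist_shootingField_le (Ioc_subset_Icc_self ht)
            (hβ t (Ioc_subset_Icc_self ht)) p q).lipschitzOnWith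
      · have := (hα _ (hball κ hκ)).2 t (Ioc_subset_Icc_self ht)
        exact this.mono_of_mem_nhdsWithin (Icc_mem_nhdsLE_of_mem ht)
      · have : shootingField β t (κ, 0) = 0 := by
          simp [shootingField, clampedCos_of_le hcon]
        rw [this]
        exact hasDerivWithinAt_const _ _ _
    have h0 := heq h01
    rw [h0] at hκ0
    simp only at hκ0
    linarith [Real.pi_pos]
  have hrange : ∀ t ∈ Icc (0 : ℝ) 1, U κ t ∈ Ioc (-(Real.pi / 2)) 0 := fun t ht =>
    ⟨hκpi.trans_le (hU1.ge.trans (hanti t ht 1 h11 ht.2)), (hanti 0 h01 t ht ht.1).trans hU0.le⟩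
  obtain ⟨K, hK⟩ := exists_extendK_eqOn (pU.continuousOn zero_le_one)
  refine ⟨K, ⟨(pU.congr_fun zero_le_one hK).congr_deriv zero_le_one fun t ht => ?_, ?_⟩,
    fun t ht => hK ht ▸ hrange t ht⟩
  · simp only [hMt t ht, moment]
    congr 2
    refine intervalIntegral.integral_congr fun r hr => ?_
    rw [uIcc_of_le ht.2] at hr
    have hr' : r ∈ Icc (0 : ℝ) 1 := ⟨ht.1.trans hr.1, hr.2⟩
    simp only [hh]
    rw [clampedCos_of_mem (Ioc_subset_Icc_self (hrange r hr')), hK hr']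
  · rw [← hK h01, hU0]

/-! ### Primitives of designs -/

lemma ae_restrict_of_ae_volI {P : ℝ → Prop} (h : ∀ᵐ t ∂volI, P t) {s t : ℝ}
    (hs : s ∈ Icc (0 : ℝ) 1) (ht : t ∈ Icc (0 : ℝ) 1) :
    ∀ᵐ r ∂volume.restrict (uIoc s t), P r := by
  refine ae_restrict_of_ae_restrict_of_subset (t := Ioc 0 1)
    (Ioc_subset_Ioc (le_min hs.1 ht.1) (max_le hs.2 ht.2)) ?_
  rwa [Measure.restrict_congr_set Ioo_ae_eq_Ioc.symm]

lemma intervalIntegral_congr_volI {f g : ℝ → ℝ} (h : f =ᵐ[volI] g) {s t : ℝ}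
    (hs : s ∈ Icc (0 : ℝ) 1) (ht : t ∈ Icc (0 : ℝ) 1) :
    ∫ r in s..t, f r = ∫ r in s..t, g r :=
  intervalIntegral.integral_congr_ae_restrict (ae_restrict_of_ae_volI h hs ht)

/-- The amount of material `∫_0^t θ` on `[0, t]`. -/
noncomputable def mass (θ : ℝ → ℝ) (t : ℝ) : ℝ := ∫ s in (0 : ℝ)..t, θ s

lemma mass_zero (θ : ℝ → ℝ) : mass θ 0 = 0 := intervalIntegral.integral_same

lemma intervalIntegrable_design (θ : Lp ℝ ⊤ volI) {s t : ℝ}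
    (hs : s ∈ Icc (0 : ℝ) 1) (ht : t ∈ Icc (0 : ℝ) 1) : IntervalIntegrable θ volume s t := by
  have h : IntervalIntegrable θ volume 0 1 :=
    integrable_volI_iff.1 ((Lp.memLp θ).integrable (by simp))
  exact h.mono_set (uIcc_subset_uIcc (Icc_subset_uIcc hs) (Icc_subset_uIcc ht))

lemma mass_sub (θ : Lp ℝ ⊤ volI) {s t : ℝ}
    (hs : s ∈ Icc (0 : ℝ) 1) (ht : t ∈ Icc (0 : ℝ) 1) :
    mass θ t - mass θ s = ∫ r in s..t, θ r := by
  have h0 : (0 : ℝ) ∈ Icc (0 : ℝ) 1 := left_mem_Icc.2 zero_le_one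
  exact intervalIntegral.integral_interval_sub_left (intervalIntegrable_design θ h0 ht)
    (intervalIntegrable_design θ h0 hs)

lemma mass_sub_mem {θ : Lp ℝ ⊤ volI} (hθ : θ ∈ relaxedDesigns) {s t : ℝ}
    (hs : s ∈ Icc (0 : ℝ) 1) (ht : t ∈ Icc (0 : ℝ) 1) (hst : s ≤ t) :
    mass θ t - mass θ s ∈ Icc 0 (t - s) := by
  have hae := ae_restrict_of_ae_volI hθ hs ht
  rw [uIoc_of_le hst] at hae
  rw [mass_sub θ hs ht]
  constructor
  · rw [intervalIntegral.integral_of_le hst]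
    exact integral_nonneg_of_ae (hae.mono fun r hr => hr.1)
  · have : ∫ r in s..t, θ r ≤ ∫ r in s..t, (1 : ℝ) := by
      rw [intervalIntegral.integral_of_le hst, intervalIntegral.integral_of_le hst]
      exact integral_mono_ae (intervalIntegrable_design θ hs ht).1 (by simp)
        (hae.mono fun r hr => hr.2)
    simpa using this

lemma classicalDesigns_subset : classicalDesigns ⊆ relaxedDesigns := fun χ hχ => by
  refine Filter.Eventually.mono (show ∀ᵐ t ∂volI, χ t ∈ ({0, 1} : Set ℝ) from hχ) fun t ht => ?_
  rcases (show χ t = 0 ∨ χ t = 1 from ht) with h | h <;> norm_num [h]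

lemma exists_ae_eq_of_bounded {ρ : ℝ → ℝ} (hρ : Measurable ρ) (h : ∀ t, ρ t ∈ Icc (0 : ℝ) 1) :
    ∃ θ : Lp ℝ ⊤ volI, θ =ᵐ[volI] ρ := by
  have : MemLp ρ ⊤ volI := memLp_top_of_bound hρ.aestronglyMeasurable 1
    (Filter.Eventually.of_forall fun t => abs_le.2 ⟨by linarith [(h t).1], (h t).2⟩)
  exact ⟨this.toLp ρ, this.coeFn_toLp⟩

section compactness

/-- The primitives of relaxed designs: the nondecreasing `1`-Lipschitz functions on `[0, 1]` that
vanish at `0`. -/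
def massFunctions : Set C(Icc (0 : ℝ) 1, ℝ) :=
  {Θ | Θ 0 = 0 ∧ ∀ s t : Icc (0 : ℝ) 1, s ≤ t → Θ t - Θ s ∈ Icc 0 ((t : ℝ) - s)}

lemma lipschitzWith_of_sub_mem {f : Icc (0 : ℝ) 1 → ℝ}
    (h : ∀ s t : Icc (0 : ℝ) 1, s ≤ t → f t - f s ∈ Icc 0 ((t : ℝ) - s)) : LipschitzWith 1 f := by
  refine LipschitzWith.of_dist_le_mul fun s t => ?_
  rw [NNReal.coe_one, one_mul]
  wlog hst : s ≤ t generalizing s t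
  · rw [dist_comm, dist_comm s t]
    exact this t s (le_of_not_ge hst)
  have h' := h s t hst
  rw [dist_comm, dist_comm s t, Real.dist_eq, Subtype.dist_eq, Real.dist_eq, abs_of_nonneg h'.1]
  exact h'.2.trans (le_abs_self _)

/-- By Arzelà-Ascoli. -/
lemma isCompact_massFunctions : IsCompact massFunctions := by
  refine ArzelaAscoli.isCompact_of_equicontinuous _ ?_ ?_
  · have himage : ContinuousMap.toFun '' massFunctions =
        {f : Icc (0 : ℝ) 1 → ℝ | f 0 = 0 ∧
          ∀ s t : Icc (0 : ℝ) 1, s ≤ t → f t - f s ∈ Icc 0 ((t : ℝ) - s)} := by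
      ext f
      constructor
      · rintro ⟨Θ, hΘ, rfl⟩
        exact hΘ
      · exact fun hf => ⟨⟨f, (lipschitzWith_of_sub_mem hf.2).continuous⟩, hf, rfl⟩
    rw [himage]
    refine (isCompact_univ_pi fun _ : Icc (0 : ℝ) 1 => isCompact_Icc (a := (0 : ℝ)) (b := 1))
      |>.of_isClosed_subset ?_ ?_
    · simp only [ofPred_and, ofPred_forall]
      refine (isClosed_eq (continuous_apply _) continuous_const).inter
        (isClosed_iInter fun s => isClosed_iInter fun t => isClosed_iInter fun _ => ?_)
      exact isClosed_Icc.preimage ((continuous_apply t).sub (continuous_apply s))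
    · rintro f ⟨h0, hf⟩ t -
      have := hf 0 t t.2.1
      rw [h0, sub_zero] at this
      exact ⟨this.1, this.2.trans (by simpa using t.2.2)⟩
  · exact (LipschitzWith.uniformEquicontinuous _ 1
      fun Θ : massFunctions => lipschitzWith_of_sub_mem Θ.2.2).equicontinuous

lemma exists_mem_massFunctions {θ : Lp ℝ ⊤ volI} (hθ : θ ∈ relaxedDesigns) :
    ∃ Θ ∈ massFunctions, ∀ t : Icc (0 : ℝ) 1, Θ t = mass θ t := by
  have h : ∀ s t : Icc (0 : ℝ) 1, s ≤ t → mass θ t - mass θ s ∈ Icc 0 ((t : ℝ) - s) :=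
    fun s t hst => mass_sub_mem hθ s.2 t.2 hst
  exact ⟨⟨fun t => mass θ t, (lipschitzWith_of_sub_mem h).continuous⟩, ⟨mass_zero _, h⟩,
    fun _ => rfl⟩

/-- A Lipschitz function is the primitive of its derivative. -/
lemma exists_design_of_mem_massFunctions {Θ : C(Icc (0 : ℝ) 1, ℝ)} (hΘ : Θ ∈ massFunctions) :
    ∃ θ ∈ relaxedDesigns, ∀ t : Icc (0 : ℝ) 1, mass θ t = Θ t := by
  have hmono : Monotone (extendK Θ) :=
    Monotone.IccExtend zero_le_one fun s t hst => sub_nonneg.1 (hΘ.2 s t hst).1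
  have hlip : LipschitzWith 1 (extendK Θ) := by
    have := (lipschitzWith_of_sub_mem hΘ.2).comp (LipschitzWith.projIcc (zero_le_one' ℝ))
    rwa [one_mul] at this
  have hder : ∀ t, deriv (extendK Θ) t ∈ Icc (0 : ℝ) 1 := fun t =>
    ⟨hmono.deriv_nonneg, (le_abs_self _).trans (by
      simpa using norm_deriv_le_of_lipschitz (x₀ := t) hlip)⟩
  obtain ⟨θ, hθ⟩ := exists_ae_eq_of_bounded (measurable_deriv _) hder
  refine ⟨θ, hθ.mono fun t ht => ht ▸ hder t, fun t => ?_⟩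
  have hac : AbsolutelyContinuousOnInterval (extendK Θ) 0 t :=
    hlip.lipschitzOnWith.absolutelyContinuousOnInterval
  rw [mass, intervalIntegral_congr_volI hθ (left_mem_Icc.2 zero_le_one) t.2,
    hac.integral_deriv_eq_sub, extendK, IccExtend_val,
    IccExtend_of_mem _ _ (left_mem_Icc.2 zero_le_one)]
  exact sub_eq_self.2 hΘ.1

end compactness

/-- Every relaxed design is approximated by classical ones, in the sense that the amounts of
material on `[0, t]` are uniformly close: on each of `n` equal cells a classical design puts the
same amount of material at the left end of the cell. -/
lemma exists_classical_approx {θ : Lp ℝ ⊤ volI} (hθ : θ ∈ relaxedDesigns) {n : ℕ} (hn : 0 < n) :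
    ∃ χ ∈ classicalDesigns, ∀ t ∈ Icc (0 : ℝ) 1, |mass χ t - mass θ t| ≤ 1 / n := by
  classical
  have hn' : (0 : ℝ) < n := Nat.cast_pos.2 hn
  set m : ℕ → ℝ := fun k => mass θ ((k + 1 : ℕ) / n) - mass θ (k / n) with hm
  have hmeas : Measurable fun t : ℝ => m ⌊n * t⌋₊ :=
    (measurable_of_countable m).comp (Nat.measurable_floor.comp (measurable_const_mul _))
  have hmeas' : Measurable fun t : ℝ => t - (⌊n * t⌋₊ : ℝ) / n :=
    measurable_id.sub (((measurable_of_countable (fun k : ℕ => (k : ℝ))).comp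
      (Nat.measurable_floor.comp (measurable_const_mul _))).div_const _)
  set ρ : ℝ → ℝ := fun t => if t - (⌊n * t⌋₊ : ℝ) / n < m ⌊n * t⌋₊ then 1 else 0 with hρ
  have hρm : Measurable ρ :=
    Measurable.ite (measurableSet_lt hmeas' hmeas) measurable_const measurable_const
  have hρ01 : ∀ t, ρ t = 0 ∨ ρ t = 1 := fun t => by
    simp only [hρ]; split_ifs <;> simp
  obtain ⟨χ, hχ⟩ := exists_ae_eq_of_bounded hρm fun t => by
    rcases hρ01 t with h | h <;> norm_num [h]
  have hχc : χ ∈ classicalDesigns := hχ.mono fun t ht => ht ▸ hρ01 t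
  have hmem : ∀ k : ℕ, k ≤ n → (k / n : ℝ) ∈ Icc (0 : ℝ) 1 := fun k hk =>
    ⟨by positivity, (div_le_one hn').2 (Nat.cast_le.2 hk)⟩
  have hcell : ∀ k : ℕ, k < n → mass χ ((k + 1 : ℕ) / n) - mass χ (k / n) = m k := by
    intro k hk
    have hk0 := hmem k hk.le
    have hk1 := hmem (k + 1) hk
    have hlen : ((k + 1 : ℕ) / n : ℝ) = k / n + 1 / n := by push_cast; ring
    have hmk : m k ∈ Icc (0 : ℝ) (1 / n) := by
      have := mass_sub_mem hθ hk0 hk1 (by rw [hlen]; linarith [one_div_pos.2 hn'])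
      rwa [hlen, add_sub_cancel_left, ← hlen] at this
    have hfloor : ∀ t ∈ Ioo (k / n : ℝ) ((k + 1 : ℕ) / n), ⌊n * t⌋₊ = k := by
      intro t ht
      rw [Nat.floor_eq_iff (by have := hk0.1.trans ht.1.le; positivity)]
      have h1 := (div_lt_iff₀' hn').1 ht.1
      have h2 := (lt_div_iff₀' hn').1 ht.2
      push_cast at h2
      exact ⟨h1.le, h2⟩
    have e₁ : ∫ t in (k / n : ℝ)..(k / n + m k), ρ t = m k := by
      have : ∫ t in (k / n : ℝ)..(k / n + m k), ρ t = ∫ t in (k / n : ℝ)..(k / n + m k), 1 := by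
        refine intervalIntegral.integral_congr_Ioo_of_le (by linarith [hmk.1]) fun t ht => ?_
        simp only [hρ]
        rw [hfloor t ⟨ht.1, by rw [hlen]; linarith [ht.2, hmk.2]⟩, if_pos (by linarith [ht.2])]
      rw [this]; simp
    have e₂ : ∫ t in (k / n + m k : ℝ)..((k + 1 : ℕ) / n), ρ t = 0 := by
      have : ∫ t in (k / n + m k : ℝ)..((k + 1 : ℕ) / n), ρ t =
          ∫ t in (k / n + m k : ℝ)..((k + 1 : ℕ) / n), 0 := by
        refine intervalIntegral.integral_congr_Ioo_of_le (by rw [hlen]; linarith [hmk.2])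
          fun t ht => ?_
        simp only [hρ]
        rw [hfloor t ⟨by linarith [ht.1, hmk.1], ht.2⟩, if_neg (by linarith [ht.1])]
      rw [this]; simp
    have hi : ∀ p q : ℝ, IntervalIntegrable ρ volume p q := fun p q => by
      rw [intervalIntegrable_iff]
      exact Measure.integrableOn_of_bounded (M := 1) (by simp) hρm.aestronglyMeasurable
        (Filter.Eventually.of_forall fun t => by rcases hρ01 t with h | h <;> norm_num [h])
    rw [mass_sub χ hk0 hk1, intervalIntegral_congr_volI hχ hk0 hk1,
      ← intervalIntegral.integral_add_adjacent_intervals (hi _ (k / n + m k)) (hi _ _), e₁, e₂,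
      add_zero]
  have hnode : ∀ k : ℕ, k ≤ n → mass χ (k / n) = mass θ (k / n) := by
    intro k
    induction k with
    | zero => intro _; simp [mass_zero]
    | succ k ih =>
      intro hk
      have h1 := hcell k hk
      have h2 := ih (Nat.le_of_succ_le hk)
      simp only [hm] at h1
      linarith
  refine ⟨χ, hχc, fun t ht => ?_⟩
  have hnt : 0 ≤ n * t := mul_nonneg hn'.le ht.1
  have hkn : ⌊n * t⌋₊ ≤ n :=
    Nat.floor_le_of_le (mul_le_of_le_one_right hn'.le ht.2)
  have hk := hmem _ hkn
  have hkt : (⌊n * t⌋₊ / n : ℝ) ≤ t := (div_le_iff₀' hn').2 (Nat.floor_le hnt)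
  have hkt' : t - (⌊n * t⌋₊ / n : ℝ) ≤ 1 / n := by
    rw [sub_le_iff_le_add, ← add_div, le_div_iff₀' hn']
    linarith [Nat.lt_floor_add_one (n * t)]
  have h1 := mass_sub_mem (classicalDesigns_subset hχc) hk ht hkt
  have h2 := mass_sub_mem hθ hk ht hkt
  rw [hnode _ hkn] at h1
  rw [abs_le]
  constructor <;> linarith [h1.1, h1.2, h2.1, h2.2]

/-! ### The compliance and its minimization -/

section state

variable {a b : ℝ} {θ : Lp ℝ ⊤ volI}

/-- The flexibility `1 / A(θ)` of a relaxed design; the density `θ`, which is only defined up to a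
null set, is clamped so that the bounds hold everywhere. -/
noncomputable def flexibility (a b : ℝ) (θ : ℝ → ℝ) (t : ℝ) : ℝ :=
  (1 - max 0 (min 1 (θ t))) / a + max 0 (min 1 (θ t)) / b

lemma flexibility_ae_eq (hθ : θ ∈ relaxedDesigns) :
    flexibility a b θ =ᵐ[volI] fun t => (1 - θ t) / a + θ t / b :=
  Filter.Eventually.mono (show ∀ᵐ t ∂volI, θ t ∈ Icc (0 : ℝ) 1 from hθ) fun t ht => by
    simp only [flexibility, min_eq_right ht.2, max_eq_right ht.1]

lemma flexibility_mem (ha : 0 < a) (hab : a < b) (θ : ℝ → ℝ) (t : ℝ) :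
    flexibility a b θ t ∈ Icc (1 / b) (1 / a) := by
  have hba : 1 / b ≤ 1 / a := one_div_le_one_div_of_le ha hab.le
  have e : flexibility a b θ t =
      (1 - max 0 (min 1 (θ t))) * (1 / a) + max 0 (min 1 (θ t)) * (1 / b) := by
    simp only [flexibility, div_eq_mul_one_div (1 - max 0 (min 1 (θ t))) a,
      div_eq_mul_one_div (max 0 (min 1 (θ t))) b]
  have h0 : 0 ≤ max 0 (min 1 (θ t)) := le_max_left _ _
  have h1 : max 0 (min 1 (θ t)) ≤ 1 := max_le zero_le_one (min_le_left _ _)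
  rw [e]
  constructor <;> nlinarith

lemma isFlexibility (ha : 0 < a) (hab : a < b) (θ : Lp ℝ ⊤ volI) :
    IsFlexibility (flexibility a b θ) (1 / a) where
  measurable := by
    have : Measurable θ := (Lp.stronglyMeasurable θ).measurable
    unfold flexibility
    fun_prop
  nonneg t := (one_div_pos.2 (ha.trans hab)).le.trans (flexibility_mem ha hab θ t).1
  le t := (flexibility_mem ha hab θ t).2

lemma solvesState_coeff_iff (ha : 0 < a) (hab : a < b) (hθ : θ ∈ relaxedDesigns)
    (K : C(Icc (0 : ℝ) 1, ℝ)) :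
    SolvesState gravity (coeff a b θ) K ↔ IsEquilibrium (flexibility a b θ) (extendK K) :=
  solvesState_iff (one_div_pos.2 (ha.trans hab)) (fun t => (flexibility_mem ha hab θ t).1)
    (isFlexibility ha hab θ)
    ((flexibility_ae_eq hθ).mono fun t ht => by rw [coeff, ht]) K

/-- By continuity, a member of `X̃` takes its values in `[-π/2, 0]`, also at `t = 1`. -/
lemma mem_Icc_of_mem_Xtilde {K : C(Icc (0 : ℝ) 1, ℝ)} (hK : K ∈ Xtilde) :
    ∀ t ∈ Icc (0 : ℝ) 1, extendK K t ∈ Icc (-(Real.pi / 2)) 0 := by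
  intro t ht
  rw [← closure_Ico (zero_ne_one' ℝ)] at ht
  exact isClosed_Icc.closure_subset
    (map_mem_closure (continuous_extendK K) ht fun s hs => Ioc_subset_Icc_self (hK.2 s hs))

theorem existsUnique_state (ha : 0 < a) (hab : a < b) (hθ : θ ∈ relaxedDesigns) :
    ∃! K, K ∈ Xtilde ∧ SolvesState gravity (coeff a b θ) K := by
  have hB := isFlexibility ha hab θ
  obtain ⟨K, hK, hr⟩ := exists_isEquilibrium hB
  have hS := (solvesState_coeff_iff ha hab hθ K).2 hK
  refine ⟨K, ⟨⟨hS.1, fun t ht => hr t (Ico_subset_Icc_self ht)⟩, hS⟩, fun K' ⟨hX, hS'⟩ => ?_⟩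
  have heq := ((solvesState_coeff_iff ha hab hθ K').1 hS').eqOn hB (continuous_extendK K')
    (continuous_extendK K) hK (mem_Icc_of_mem_Xtilde hX)
    fun t ht => Ioc_subset_Icc_self (hr t ht)
  ext t
  simpa [extendK, IccExtend_val] using heq t.2

lemma state_spec (ha : 0 < a) (hab : a < b) (hθ : θ ∈ relaxedDesigns) :
    IsEquilibrium (flexibility a b θ) (extendK (state a b θ)) ∧
      ∀ t ∈ Icc (0 : ℝ) 1, extendK (state a b θ) t ∈ Icc (-(Real.pi / 2)) 0 := by
  have h := (existsUnique_state ha hab hθ).exists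
  have hs : state a b θ = h.choose := by rw [state, dif_pos h]
  rw [hs]
  exact ⟨(solvesState_coeff_iff ha hab hθ _).1 h.choose_spec.2,
    mem_Icc_of_mem_Xtilde h.choose_spec.1⟩

lemma integral_flexibility (hθ : θ ∈ relaxedDesigns) {t : ℝ} (ht : t ∈ Icc (0 : ℝ) 1) :
    ∫ s in (0 : ℝ)..t, flexibility a b θ s = t / a - (1 / a - 1 / b) * mass θ t := by
  have h0 : (0 : ℝ) ∈ Icc (0 : ℝ) 1 := left_mem_Icc.2 zero_le_one
  rw [intervalIntegral_congr_volI (flexibility_ae_eq hθ) h0 ht, mass,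
    ← intervalIntegral.integral_const_mul]
  have e : ∀ s, (1 - θ s) / a + θ s / b = 1 / a - (1 / a - 1 / b) * θ s := fun s => by ring
  simp only [e]
  rw [intervalIntegral.integral_sub intervalIntegrable_const
    ((intervalIntegrable_design θ h0 ht).const_mul _)]
  simp only [intervalIntegral.integral_const, smul_eq_mul]
  ring

lemma Jhat_eq (a b c : ℝ) (θ : Lp ℝ ⊤ volI) :
    Jhat a b c θ =
      (∫ t in (0 : ℝ)..1, -((1 - t) * Real.sin (extendK (state a b θ) t))) + c * mass θ 1 := by
  rw [Jhat, J, integral_volI, integral_volI, mass]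
  simp only [inner_gravity_exp]

/-- The compliance is uniformly continuous as a function of the primitive of the design. -/
lemma exists_forall_abs_Jhat_sub_le (ha : 0 < a) (hab : a < b) {c η : ℝ} (hc : 0 < c)
    (hη : 0 < η) :
    ∃ δ > 0, ∀ θ₁ ∈ relaxedDesigns, ∀ θ₂ ∈ relaxedDesigns,
      (∀ t ∈ Icc (0 : ℝ) 1, |mass θ₁ t - mass θ₂ t| ≤ δ) →
        |Jhat a b c θ₁ - Jhat a b c θ₂| ≤ η := by
  have hb : 0 < b := ha.trans hab
  set ε := a * η / 4 with hε
  have hε0 : 0 < ε := by positivity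
  refine ⟨min (a * ε * η / 16) (min (a * η / 8) (η / (4 * c))), by positivity,
    fun θ₁ h₁ θ₂ h₂ hδ => ?_⟩
  set δ := min (a * ε * η / 16) (min (a * η / 8) (η / (4 * c))) with hδdef
  have hδ0 : 0 ≤ δ := by positivity
  have d₁ : 4 * (δ / a) / ε ≤ η / 4 := by
    have := min_le_left (a * ε * η / 16) (min (a * η / 8) (η / (4 * c)))
    rw [← hδdef] at this
    rw [div_le_iff₀ hε0, mul_div_assoc', div_le_iff₀ ha]
    linarith
  have d₂ : 2 * (δ / a) ≤ η / 4 := by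
    have := (min_le_right (a * ε * η / 16) _).trans (min_le_left (a * η / 8) (η / (4 * c)))
    rw [← hδdef] at this
    rw [mul_div_assoc', div_le_iff₀ ha]
    linarith
  have d₃ : c * δ ≤ η / 4 := by
    have := (min_le_right (a * ε * η / 16) _).trans (min_le_right (a * η / 8) (η / (4 * c)))
    rw [← hδdef, le_div_iff₀ (by positivity)] at this
    linarith
  have d₀ : ε * (1 / a) = η / 4 := by rw [hε]; field_simp
  obtain ⟨e₁, r₁⟩ := state_spec ha hab h₁
  obtain ⟨e₂, r₂⟩ := state_spec ha hab h₂
  have hd : ∀ t ∈ Icc (0 : ℝ) 1, |(∫ s in (0 : ℝ)..t, flexibility a b θ₁ s)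
      - ∫ s in (0 : ℝ)..t, flexibility a b θ₂ s| ≤ δ / a := by
    intro t ht
    have hnn : 0 ≤ 1 / a - 1 / b := sub_nonneg.2 (one_div_le_one_div_of_le ha hab.le)
    rw [integral_flexibility h₁ ht, integral_flexibility h₂ ht, sub_sub_sub_cancel_left,
      ← mul_sub, abs_mul, abs_of_nonneg hnn, abs_sub_comm, div_eq_mul_one_div δ a, mul_comm]
    exact mul_le_mul (hδ t ht) (by linarith [one_div_pos.2 hb]) hnn hδ0
  have hK : ∀ t ∈ Icc (0 : ℝ) 1,
      |extendK (state a b θ₁) t - extendK (state a b θ₂) t| ≤ 3 * η / 4 := fun t ht => by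
    have := abs_sub_le_of_isEquilibrium (isFlexibility ha hab θ₁) (isFlexibility ha hab θ₂)
      (continuous_extendK _) (continuous_extendK _) e₁ e₂ r₁ r₂ hd hε0 ht
    linarith
  have i : ∀ θ : Lp ℝ ⊤ volI, IntervalIntegrable
      (fun t => -((1 - t) * Real.sin (extendK (state a b θ) t))) volume 0 1 := fun θ => by
    have := continuous_extendK (state a b θ)
    apply Continuous.intervalIntegrable
    fun_prop
  have hsin : |(∫ t in (0 : ℝ)..1, -((1 - t) * Real.sin (extendK (state a b θ₁) t)))
      - ∫ t in (0 : ℝ)..1, -((1 - t) * Real.sin (extendK (state a b θ₂) t))| ≤ 3 * η / 4 := by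
    rw [← intervalIntegral.integral_sub (i θ₁) (i θ₂)]
    refine abs_integral_le_of_le (by positivity) (right_mem_Icc.2 zero_le_one) fun t ht => ?_
    rw [neg_sub_neg, ← mul_sub, abs_mul, abs_sub_comm (Real.sin _)]
    refine le_trans ?_ (hK t ht)
    exact (mul_le_of_le_one_left (abs_nonneg _)
      (abs_le.2 ⟨by linarith [ht.2], by linarith [ht.1]⟩)).trans (Real.abs_sin_sub_sin_le _ _)
  have hmass : |c * mass θ₁ 1 - c * mass θ₂ 1| ≤ η / 4 := by
    rw [← mul_sub, abs_mul, abs_of_pos hc]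
    exact (mul_le_mul_of_nonneg_left (hδ 1 (right_mem_Icc.2 zero_le_one)) hc.le).trans d₃
  rw [Jhat_eq, Jhat_eq]
  rw [abs_le] at hsin hmass ⊢
  constructor <;> linarith [hsin.1, hsin.2, hmass.1, hmass.2]

/-- The minimum is attained, as the compliance is a continuous function of the primitive of the
design, which ranges over a compact set. -/
lemma exists_isMinOn_Jhat (ha : 0 < a) (hab : a < b) {c : ℝ} (hc : 0 < c) :
    ∃ θ ∈ relaxedDesigns, ∀ θ' ∈ relaxedDesigns, Jhat a b c θ ≤ Jhat a b c θ' := by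
  have hex : ∀ Θ : C(Icc (0 : ℝ) 1, ℝ), ∃ θ : Lp ℝ ⊤ volI, Θ ∈ massFunctions →
      θ ∈ relaxedDesigns ∧ ∀ t : Icc (0 : ℝ) 1, mass θ t = Θ t := fun Θ => by
    by_cases hΘ : Θ ∈ massFunctions
    · obtain ⟨θ, h⟩ := exists_design_of_mem_massFunctions hΘ
      exact ⟨θ, fun _ => h⟩
    · exact ⟨0, fun h => absurd h hΘ⟩
  choose q hq using hex
  have hcont : ContinuousOn (fun Θ => Jhat a b c (q Θ)) massFunctions := by
    refine Metric.continuousOn_iff.2 fun Θ₀ h₀ η hη => ?_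
    obtain ⟨δ, hδ, h⟩ := exists_forall_abs_Jhat_sub_le ha hab hc (half_pos hη)
    refine ⟨δ, hδ, fun Θ hΘ hdist => ?_⟩
    refine (h _ (hq Θ hΘ).1 _ (hq Θ₀ h₀).1 fun t ht => ?_).trans_lt (half_lt_self hη)
    rw [(hq Θ hΘ).2 ⟨t, ht⟩, (hq Θ₀ h₀).2 ⟨t, ht⟩, ← Real.dist_eq]
    exact (ContinuousMap.dist_apply_le_dist _).trans hdist.le
  have hne : massFunctions.Nonempty := ⟨0, rfl, fun s t hst => by simpa using hst⟩
  obtain ⟨Θ, hΘ, hmin⟩ := isCompact_massFunctions.exists_isMinOn hne hcont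
  refine ⟨q Θ, (hq Θ hΘ).1, fun θ' hθ' => ?_⟩
  obtain ⟨Θ', hΘ', hm⟩ := exists_mem_massFunctions hθ'
  refine (hmin hΘ').trans (le_of_forall_pos_le_add fun η hη => ?_)
  -- `θ'` and the design chosen for its primitive have the same compliance.
  obtain ⟨δ, hδ, h⟩ := exists_forall_abs_Jhat_sub_le ha hab hc hη
  have := h _ (hq Θ' hΘ').1 _ hθ' fun t ht => by
    rw [(hq Θ' hΘ').2 ⟨t, ht⟩, hm ⟨t, ht⟩, sub_self, abs_zero]
    exact hδ.le
  linarith [(abs_le.1 this).2]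

end state
end Beam

theorem mainTheorem2 (a b c : ℝ) (ha : 0 < a) (hab : a < b) (hc : 0 < c) :
    (∀ θ ∈ Beam.relaxedDesigns,
      ∃! K, K ∈ Beam.Xtilde ∧ Beam.SolvesState Beam.gravity (Beam.coeff a b θ) K) ∧
    ∃ θ ∈ Beam.relaxedDesigns,
      IsLeast (Beam.Jhat a b c '' Beam.relaxedDesigns) (Beam.Jhat a b c θ) ∧
      IsGLB (Beam.Jhat a b c '' Beam.classicalDesigns) (Beam.Jhat a b c θ) := by
  refine ⟨fun θ hθ => Beam.existsUnique_state ha hab hθ, ?_⟩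
  obtain ⟨θ, hθ, hmin⟩ := Beam.exists_isMinOn_Jhat ha hab hc
  refine ⟨θ, hθ, ⟨mem_image_of_mem _ hθ, ?_⟩, ?_, fun x hx => ?_⟩
  · rintro _ ⟨θ', hθ', rfl⟩
    exact hmin θ' hθ'
  · rintro _ ⟨χ, hχ, rfl⟩
    exact hmin χ (Beam.classicalDesigns_subset hχ)
  · refine le_of_forall_pos_le_add fun η hη => ?_
    obtain ⟨δ, hδ, h⟩ := Beam.exists_forall_abs_Jhat_sub_le ha hab hc hη
    obtain ⟨n, hn⟩ := exists_nat_one_div_lt hδ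
    obtain ⟨χ, hχ, hχθ⟩ := Beam.exists_classical_approx hθ n.succ_pos
    have h1 := h χ (Beam.classicalDesigns_subset hχ) θ hθ fun t ht =>
      (hχθ t ht).trans (by push_cast; exact hn.le)
    linarith [hx (mem_image_of_mem _ hχ), (abs_le.1 h1).2]
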